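/- Let $b_1<0<b_2$, let $n\in\{1,2,\dots\}$, and let $Q_{12},Q_{21}\in W_1^n[0,1]$ be complex-valued, where $W_1^n[0,1]$ is the space of functions $f$ on $[0,1]$ having $n-1$ derivatives such that $f,f',\dots,f^{(n-1)}$ are absolutely continuous and $f^{(n)}\in L^1[0,1]$. Consider the system $$-iB^{-1}y'+Q(x)y=\lambda y,\qquad B=\begin{pmatrix}b_1&0\\0&b_2\end{pmatrix},\quad Q=\begin{pmatrix}0&Q_{12}\\Q_{21}&0\end{pmatrix},\quad x\in[0,1],$$ and let $\Phi(x,\lambda)=(\Phi_1(x,\lambda)\ \Phi_2(x,\lambda))$ be its fundamental matrix with $\Phi(0,\lambda)=I_2$, which exists for every $\lambda\in\mathbb C$. For an arbitrary matrix $(a_{jk})\in\mathbb C^{2\times4}$ set $$U_j(y)=a_{j1}y_1(0)+a_{j2}y_2(0)+a_{j3}y_1(1)+a_{j4}y_2(1),\quad j=1,2,\qquad J_{jk}=\det\begin{pmatrix}a_{1j}&a_{1k}\\a_{2j}&a_{2k}\end{pmatrix},$$ and let $\Delta_Q(\lambda)=\det\bigl(U_j(\Phi_k(\cdot,\lambda))\bigr)_{j,k=1}^2$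 be the characteristic determinant. Put $q_+=-ib_1Q_{12}$, $q_-=-ib_2Q_{21}$, $c=i(b_1-b_2)$, and define functions $\sigma_k^\pm$ on $[0,1]$, $1\le k\le n$, by $$\sigma_1^\pm=q_\mp,\qquad \sigma_{k+1}^\pm=-(\sigma_k^\pm)'-q_\pm\sum_{j=1}^{k-1}\sigma_j^\pm\sigma_{k-j}^\pm .$$ For $1\le k\le n$ let $$c_k^+=J_{13}(-1)^{k-1}\sigma_k^-(0)+J_{42}\sigma_k^+(1)-J_{14}\sum_{j=1}^{k-1}(-1)^j\sigma_j^-(0)\sigma_{k-j}^+(1),$$ $$c_k^-=J_{13}(-1)^{k-1}\sigma_k^-(1)+J_{42}\sigma_k^+(0)+J_{32}\sum_{j=1}^{k-1}(-1)^j\sigma_j^-(1)\sigma_{k-j}^+(0).$$ Let $\beta=\min(|b_1|,b_2)$. Then $$\Delta_Q(\lambda)=e^{ib_1\lambda}\Bigl(J_{32}+\sum_{k=1}^n\frac{c_k^+}{(c\lambda)^k}+o(\lambda^{-n})\Bigr)(1+o(1)),\qquad \operatorname{Im}\lambda\to+\infty,$$ $$\Delta_Q(\lambda)=e^{ib_2\lambda}\Bigl(J_{14}-\sum_{k=1}^n\frac{c_k^-}{(c\lambda)^k}+o(\lambda^{-n})\Bigr)(1+o(1)),\qquad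 \operatorname{Im}\lambda\to-\infty,$$ where in both limits $\lambda$ is restricted so that $|\lambda|^n e^{-\beta|\operatorname{Im}\lambda|}\to0$. (This restriction holds automatically when $|\operatorname{Re}\lambda|\le M|\operatorname{Im}\lambda|^m$ for some constants $M,m$, in particular on the imaginary axis and in every sector $|\operatorname{Re}\lambda|\le M|\operatorname{Im}\lambda|$.) -/

import Mathlib

open Set Filter Topology MeasureTheory Asymptotics

namespace DiracType

noncomputable section

/-- The Sobolev space `W_1^n[0,1]`: `f` is `n - 1` times differentiable on `[0,1]`, the functions
`f, f', …, f^{(n-1)}` are absolutely continuous on `[0,1]`, and `f^{(n)} ∈ L^1[0,1]`.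
For `n = 0` this is `L^1[0,1]`. -/
def SobolevW1 (n : ℕ) (f : ℝ → ℂ) : Prop :=
  (∀ k : ℕ, k + 1 < n →
    DifferentiableOn ℝ (iteratedDerivWithin k f (Icc 0 1)) (Icc 0 1)) ∧
  (∀ k : ℕ, k < n →
    AbsolutelyContinuousOnInterval (iteratedDerivWithin k f (Icc 0 1)) 0 1) ∧
  IntegrableOn (iteratedDerivWithin n f (Icc 0 1)) (Icc 0 1) volume

/-- `B = diag(b₁, b₂)`. -/
def matB (b₁ b₂ : ℝ) : Matrix (Fin 2) (Fin 2) ℂ := !![(b₁ : ℂ), 0; 0, (b₂ : ℂ)]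

/-- The potential matrix with zero diagonal and off-diagonal entries `Q₁₂`, `Q₂₁`. -/
def potential (Q₁₂ Q₂₁ : ℝ → ℂ) (x : ℝ) : Matrix (Fin 2) (Fin 2) ℂ := !![0, Q₁₂ x; Q₂₁ x, 0]

/-- `y` is a solution on `[0,1]`, in the class `W_1^1([0,1]; ℂ²)`, of the system
`-i B⁻¹ y' + Q(x) y = z y` (the equation holds for almost every `x ∈ [0,1]`). -/
def IsSolution (b₁ b₂ : ℝ) (Q₁₂ Q₂₁ : ℝ → ℂ) (z : ℂ) (y : ℝ → Fin 2 → ℂ) : Prop :=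
  (∀ j, SobolevW1 1 (fun x => y x j)) ∧
  ∀ᵐ x ∂(volume.restrict (Icc (0 : ℝ) 1)),
    (-Complex.I) • ((matB b₁ b₂)⁻¹.mulVec (fun j => deriv (fun t => y t j) x))
      + (potential Q₁₂ Q₂₁ x).mulVec (y x) = z • y x

/-- `Φ(x, z)`, written `Φ z x`, is the fundamental matrix of the system: for every spectral
parameter `z` its columns are solutions on `[0,1]`, and `Φ(0, z)` is the identity matrix.
This determines `Φ(x, z)` for `x ∈ [0,1]`. -/
def IsFundamentalMatrix (b₁ b₂ : ℝ) (Q₁₂ Q₂₁ : ℝ → ℂ)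
    (Φ : ℂ → ℝ → Matrix (Fin 2) (Fin 2) ℂ) : Prop :=
  ∀ z : ℂ, Φ z 0 = 1 ∧ ∀ k : Fin 2, IsSolution b₁ b₂ Q₁₂ Q₂₁ z (fun x j => Φ z x j k)

/-- The linear forms
`U_j(y) = a_{j1} y₁(0) + a_{j2} y₂(0) + a_{j3} y₁(1) + a_{j4} y₂(1)`
(rows and columns of `a` are numbered from `0` in the code). -/
def boundaryForm (a : Matrix (Fin 2) (Fin 4) ℂ) (j : Fin 2) (y : ℝ → Fin 2 → ℂ) : ℂ :=
  a j 0 * y 0 0 + a j 1 * y 0 1 + a j 2 * y 1 0 + a j 3 * y 1 1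

/-- The characteristic determinant `Δ_Q(z) = det (U_j(Φ_k(·, z)))_{j,k}`, where `Φ_k` is the
`k`-th column of `Φ`. -/
def charDet (a : Matrix (Fin 2) (Fin 4) ℂ) (Φ : ℂ → ℝ → Matrix (Fin 2) (Fin 2) ℂ) (z : ℂ) : ℂ :=
  (Matrix.of fun j k : Fin 2 => boundaryForm a j (fun x i => Φ z x i k)).det

/-- The `2 × 2` determinant formed by the columns `j`, `k` of `a`, columns being numbered
from `0`. -/
def minorJ (a : Matrix (Fin 2) (Fin 4) ℂ) (j k : Fin 4) : ℂ := (a.submatrix id ![j, k]).det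

def J13 (a : Matrix (Fin 2) (Fin 4) ℂ) : ℂ := minorJ a 0 2
def J14 (a : Matrix (Fin 2) (Fin 4) ℂ) : ℂ := minorJ a 0 3
def J32 (a : Matrix (Fin 2) (Fin 4) ℂ) : ℂ := minorJ a 2 1
def J42 (a : Matrix (Fin 2) (Fin 4) ℂ) : ℂ := minorJ a 3 1

/-- `q₊(x) = -i b₁ Q₁₂(x)`. -/
def qPlus (b₁ : ℝ) (Q₁₂ : ℝ → ℂ) (x : ℝ) : ℂ := -Complex.I * b₁ * Q₁₂ x

/-- `q₋(x) = -i b₂ Q₂₁(x)`. -/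
def qMinus (b₂ : ℝ) (Q₂₁ : ℝ → ℂ) (x : ℝ) : ℂ := -Complex.I * b₂ * Q₂₁ x

/-- The functions `σ_k` on `[0,1]` given, for a pair of functions `p`, `m`, by `σ_1 = m` and
`σ_{k+1} = -σ_k' - p ∑_{j=1}^{k-1} σ_j σ_{k-j}`, `k ≥ 1`
(`σ_0 = 0` is a convention that is not used). -/
def sigma (p m : ℝ → ℂ) : ℕ → ℝ → ℂ
  | 0 => fun _ => 0
  | 1 => m
  | k + 2 => fun x =>
      -derivWithin (sigma p m (k + 1)) (Icc 0 1) x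
        - p x * ∑ j : Fin k, sigma p m (j + 1) x * sigma p m (k - j) x
  termination_by k => k

/-- `σ_k^+`: `σ_1^+ = q₋` and `σ_{k+1}^+ = -(σ_k^+)' - q₊ ∑_{j=1}^{k-1} σ_j^+ σ_{k-j}^+`. -/
def sigmaPlus (b₁ b₂ : ℝ) (Q₁₂ Q₂₁ : ℝ → ℂ) : ℕ → ℝ → ℂ :=
  sigma (qPlus b₁ Q₁₂) (qMinus b₂ Q₂₁)

/-- `σ_k^-`: `σ_1^- = q₊` and `σ_{k+1}^- = -(σ_k^-)' - q₋ ∑_{j=1}^{k-1} σ_j^- σ_{k-j}^-`. -/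
def sigmaMinus (b₁ b₂ : ℝ) (Q₁₂ Q₂₁ : ℝ → ℂ) : ℕ → ℝ → ℂ :=
  sigma (qMinus b₂ Q₂₁) (qPlus b₁ Q₁₂)

/-- The coefficients `c_k^+`, `k ≥ 1`. -/
def cPlus (b₁ b₂ : ℝ) (Q₁₂ Q₂₁ : ℝ → ℂ) (a : Matrix (Fin 2) (Fin 4) ℂ) (k : ℕ) : ℂ :=
  J13 a * (-1) ^ (k - 1) * sigmaMinus b₁ b₂ Q₁₂ Q₂₁ k 0
    + J42 a * sigmaPlus b₁ b₂ Q₁₂ Q₂₁ k 1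
    - J14 a * ∑ j ∈ Finset.Icc 1 (k - 1),
        (-1) ^ j * sigmaMinus b₁ b₂ Q₁₂ Q₂₁ j 0 * sigmaPlus b₁ b₂ Q₁₂ Q₂₁ (k - j) 1

/-- The coefficients `c_k^-`, `k ≥ 1`. -/
def cMinus (b₁ b₂ : ℝ) (Q₁₂ Q₂₁ : ℝ → ℂ) (a : Matrix (Fin 2) (Fin 4) ℂ) (k : ℕ) : ℂ :=
  J13 a * (-1) ^ (k - 1) * sigmaMinus b₁ b₂ Q₁₂ Q₂₁ k 1
    + J42 a * sigmaPlus b₁ b₂ Q₁₂ Q₂₁ k 0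
    + J32 a * ∑ j ∈ Finset.Icc 1 (k - 1),
        (-1) ^ j * sigmaMinus b₁ b₂ Q₁₂ Q₂₁ j 1 * sigmaPlus b₁ b₂ Q₁₂ Q₂₁ (k - j) 0

/-- `c = i (b₁ - b₂)`. -/
def cConst (b₁ b₂ : ℝ) : ℂ := Complex.I * ((b₁ : ℂ) - (b₂ : ℂ))

/-- The limit `Im z → +∞`, taken along the `z` with `|z|^n exp(-β |Im z|) → 0`. For `β > 0` this
holds on every set `|Re z| ≤ M (Im z)^m`, in particular on every closed sector
`ε ≤ arg z ≤ π - ε` with `ε > 0`. -/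
def upperFilter (n : ℕ) (β : ℝ) : Filter ℂ :=
  comap Complex.im atTop ⊓ comap (fun z : ℂ => ‖z‖ ^ n * Real.exp (-β * |z.im|)) (𝓝 0)

/-- The limit `Im z → -∞`, taken along the `z` with `|z|^n exp(-β |Im z|) → 0`. -/
def lowerFilter (n : ℕ) (β : ℝ) : Filter ℂ :=
  comap Complex.im atBot ⊓ comap (fun z : ℂ => ‖z‖ ^ n * Real.exp (-β * |z.im|)) (𝓝 0)

end

end DiracType

namespace DiracType

/-! ### Absolutely continuous complex-valued functions on `[0,1]` -/

/-! Multiplying the system by `iB` gives `y₁' = ib₁z y₁ + q₊ y₂`, `y₂' = q₋ y₁ + ib₂z y₂`. The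
factor `exp(-ib₁zx)` turns this into `Y' = pZ`, `Z' = mY - ζZ` with `p = q₊`, `m = q₋`, `ζ = cz` and
`Re ζ = (b₂ - b₁) Im z → +∞`. The quotient `u = Z/Y` formally satisfies the Riccati equation `u' = m
- ζu - pu²`, and substituting a series in `1/ζ` yields exactly `∑ σ_k ζ^{-k}`. To avoid dividing by
`Y`, the proof estimates `V = Z - SY`, where `S` is the series cut at `n`. It solves the linear
equation `V' = -(ζ + pS)V + RY`, whose residual `R` is at most `|ζ|^{-n}` times a fixed integrable
function (`riccati_residual_norm_le`). The decaying kernel `exp(-Re ζ (1 - t))` then improves the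
contribution of `R` at `x = 1` to `o(|ζ|^{-n})` (`exists_deviation_bound`,
`tendsto_integral_exp_mul`, `column_estimate`).

Applied to the first column of `Φ(1, z)`, this gives `Φ₂₁ ≈ SΦ₁₁` and `exp(-ib₁z)Φ₁₁ → 1`. The first
row, completed to a solution of the adjoint system read from right to left, satisfies a system of
the same kind (`Solves.exists_first_row`), whence `Φ₁₂ ≈ TΦ₁₁`; by `sigma_reflect`, `T` has
coefficients `(-1)^{k-1}σ_k^-(0)`. The remaining entry comes from `det Φ = exp(i(b₁ + b₂)z)`. Thus
`Δ_Q/Φ₁₁` is `J₃₂ + J₁₃T + J₄₂S + J₁₄TS` up to `o(z^{-n})`: the other terms are exponentially small,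
and the filter is designed to absorb them. The factor `1 + o(1)` is `exp(-ib₁z)Φ₁₁`.

The lower half-plane follows from the upper one by `z ↦ -z` together with an exchange of the two
components (`IsFundamentalMatrix.swap`, `charDet_swapColumns`, `cPlus_swap`). -/

lemma absolutelyContinuous_of_dist_le {X Y : Type*} [PseudoMetricSpace X] [PseudoMetricSpace Y]
    {f : ℝ → X} {g : ℝ → Y} {a b : ℝ} (hf : AbsolutelyContinuousOnInterval f a b)
    (h : ∀ x ∈ uIcc a b, ∀ y ∈ uIcc a b, dist (g x) (g y) ≤ dist (f x) (f y)) :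
    AbsolutelyContinuousOnInterval g a b := by
  rw [absolutelyContinuousOnInterval_iff] at hf ⊢
  intro ε hε
  obtain ⟨δ, hδ, H⟩ := hf ε hε
  refine ⟨δ, hδ, fun E hE hlt => lt_of_le_of_lt (Finset.sum_le_sum fun i hi => ?_) (H E hE hlt)⟩
  exact h _ (hE.1 i hi).1 _ (hE.1 i hi).2

lemma absolutelyContinuous_re {f : ℝ → ℂ} {a b : ℝ} (hf : AbsolutelyContinuousOnInterval f a b) :
    AbsolutelyContinuousOnInterval (fun x => (f x).re) a b :=
  absolutelyContinuous_of_dist_le hf fun x _ y _ => by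
    rw [Real.dist_eq, dist_eq_norm, ← Complex.sub_re]; exact Complex.abs_re_le_norm _

lemma absolutelyContinuous_im {f : ℝ → ℂ} {a b : ℝ} (hf : AbsolutelyContinuousOnInterval f a b) :
    AbsolutelyContinuousOnInterval (fun x => (f x).im) a b :=
  absolutelyContinuous_of_dist_le hf fun x _ y _ => by
    rw [Real.dist_eq, dist_eq_norm, ← Complex.sub_im]; exact Complex.abs_im_le_norm _

lemma hasDerivAt_complex_of_re_im {f : ℝ → ℂ} {u v x : ℝ}
    (hu : HasDerivAt (fun t => (f t).re) u x) (hv : HasDerivAt (fun t => (f t).im) v x) :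
    HasDerivAt f (u + v * Complex.I) x := by
  have h := hu.ofReal_comp.add (hv.ofReal_comp.mul_const Complex.I)
  refine h.congr_of_eventuallyEq (Eventually.of_forall fun t => ?_)
  simp [Complex.re_add_im]

lemma absolutelyContinuous_ae_differentiableAt {f : ℝ → ℂ} {a b : ℝ}
    (hf : AbsolutelyContinuousOnInterval f a b) :
    ∀ᵐ x : ℝ, x ∈ uIcc a b → DifferentiableAt ℝ f x := by
  filter_upwards [(absolutelyContinuous_re hf).ae_differentiableAt,
    (absolutelyContinuous_im hf).ae_differentiableAt] with x h1 h2 hx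
  exact (hasDerivAt_complex_of_re_im (h1 hx).hasDerivAt (h2 hx).hasDerivAt).differentiableAt

lemma absolutelyContinuous_ae_hasDerivAt {f : ℝ → ℂ} {a b : ℝ}
    (hf : AbsolutelyContinuousOnInterval f a b) :
    ∀ᵐ x : ℝ, x ∈ uIcc a b → deriv f x =
      ((deriv (fun t => (f t).re) x : ℝ) : ℂ) + (deriv (fun t => (f t).im) x : ℝ) * Complex.I := by
  filter_upwards [(absolutelyContinuous_re hf).ae_differentiableAt,
    (absolutelyContinuous_im hf).ae_differentiableAt] with x h1 h2 hx
  exact (hasDerivAt_complex_of_re_im (h1 hx).hasDerivAt (h2 hx).hasDerivAt).deriv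

lemma absolutelyContinuous_intervalIntegrable_deriv {f : ℝ → ℂ} {a b : ℝ}
    (hf : AbsolutelyContinuousOnInterval f a b) : IntervalIntegrable (deriv f) volume a b := by
  have h1 := (absolutelyContinuous_re hf).intervalIntegrable_deriv
  have h2 := (absolutelyContinuous_im hf).intervalIntegrable_deriv
  have h3 : IntervalIntegrable (fun x => ((deriv (fun t => (f t).re) x : ℝ) : ℂ)
      + (deriv (fun t => (f t).im) x : ℝ) * Complex.I) volume a b :=
    IntervalIntegrable.add ⟨h1.1.ofReal, h1.2.ofReal⟩
      (IntervalIntegrable.mul_const ⟨h2.1.ofReal, h2.2.ofReal⟩ _)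
  refine h3.congr_ae ?_
  rw [EventuallyEq, ae_restrict_iff' measurableSet_uIoc]
  filter_upwards [absolutelyContinuous_ae_hasDerivAt hf] with x hx hx'
  exact (hx (uIoc_subset_uIcc hx')).symm

/-- The fundamental theorem of calculus for absolutely continuous complex-valued functions. -/
lemma absolutelyContinuous_integral_deriv {f : ℝ → ℂ} {a b : ℝ}
    (hf : AbsolutelyContinuousOnInterval f a b) : ∫ x in a..b, deriv f x = f b - f a := by
  have h1 := (absolutelyContinuous_re hf).intervalIntegrable_deriv
  have h2 := (absolutelyContinuous_im hf).intervalIntegrable_deriv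
  have e : ∫ x in a..b, deriv f x = ∫ x in a..b, (((deriv (fun t => (f t).re) x : ℝ) : ℂ)
      + (deriv (fun t => (f t).im) x : ℝ) * Complex.I) := by
    refine intervalIntegral.integral_congr_ae ?_
    filter_upwards [absolutelyContinuous_ae_hasDerivAt hf] with x hx hx'
    exact hx (uIoc_subset_uIcc hx')
  have i1 : IntervalIntegrable (fun x => ((deriv (fun t => (f t).re) x : ℝ) : ℂ)) volume a b :=
    ⟨h1.1.ofReal, h1.2.ofReal⟩
  have i2 : IntervalIntegrable (fun x => ((deriv (fun t => (f t).im) x : ℝ) : ℂ)) volume a b :=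
    ⟨h2.1.ofReal, h2.2.ofReal⟩
  rw [e, intervalIntegral.integral_add i1 (i2.mul_const _),
    intervalIntegral.integral_mul_const, intervalIntegral.integral_ofReal,
    intervalIntegral.integral_ofReal, (absolutelyContinuous_re hf).integral_deriv_eq_sub,
    (absolutelyContinuous_im hf).integral_deriv_eq_sub]
  apply Complex.ext <;> simp

lemma absolutelyContinuous_mul {f g : ℝ → ℂ} {a b : ℝ} (hf : AbsolutelyContinuousOnInterval f a b)
    (hg : AbsolutelyContinuousOnInterval g a b) :
    AbsolutelyContinuousOnInterval (fun x => f x * g x) a b := by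
  have h := AbsolutelyContinuousOnInterval.smul (M := ℂ) (F := ℂ) hf hg
  exact absolutelyContinuous_of_dist_le h fun x _ y _ => le_rfl

lemma absolutelyContinuous_congr {f g : ℝ → ℂ} (hf : AbsolutelyContinuousOnInterval f 0 1)
    (h : EqOn f g (Icc 0 1)) : AbsolutelyContinuousOnInterval g 0 1 :=
  absolutelyContinuous_of_dist_le hf fun x hx y hy => by
    rw [uIcc_of_le zero_le_one] at hx hy
    rw [h hx, h hy]

lemma absolutelyContinuous_of_hasDerivWithinAt {f f' : ℝ → ℂ}
    (hf : ∀ x ∈ Icc (0 : ℝ) 1, HasDerivWithinAt f (f' x) (Icc 0 1) x)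
    (hf' : ContinuousOn f' (Icc 0 1)) : AbsolutelyContinuousOnInterval f 0 1 := by
  obtain ⟨C, hC⟩ := isCompact_Icc.exists_bound_of_continuousOn hf'
  refine LipschitzOnWith.absolutelyContinuousOnInterval (K := C.toNNReal) ?_
  rw [uIcc_of_le zero_le_one]
  refine (convex_Icc 0 1).lipschitzOnWith_of_nnnorm_hasDerivWithin_le hf fun x hx => ?_
  rw [← NNReal.coe_le_coe, coe_nnnorm]
  exact (hC x hx).trans (Real.le_coe_toNNReal C)

lemma absolutelyContinuous_continuousOn {f : ℝ → ℂ} (hf : AbsolutelyContinuousOnInterval f 0 1) :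
    ContinuousOn f (Icc 0 1) := by
  simpa only [uIcc_of_le (zero_le_one' ℝ)] using hf.continuousOn

lemma uniqueDiffWithinAt_unitInterval {x : ℝ} (hx : x ∈ Icc (0 : ℝ) 1) :
    UniqueDiffWithinAt ℝ (Icc (0 : ℝ) 1) x :=
  uniqueDiffOn_Icc zero_lt_one x hx

/-- `ACDiff k f`: `f` is `k` times differentiable on `[0,1]` and its `k`-th derivative is
absolutely continuous. -/
def ACDiff : ℕ → (ℝ → ℂ) → Prop
  | 0, f => AbsolutelyContinuousOnInterval f 0 1
  | k + 1, f => DifferentiableOn ℝ f (Icc 0 1) ∧ ACDiff k (derivWithin f (Icc 0 1))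

namespace ACDiff

lemma ac {k : ℕ} {f : ℝ → ℂ} (h : ACDiff k f) : AbsolutelyContinuousOnInterval f 0 1 := by
  induction k generalizing f with
  | zero => exact h
  | succ k ih =>
    exact absolutelyContinuous_of_hasDerivWithinAt (fun x hx => (h.1 x hx).hasDerivWithinAt)
      (absolutelyContinuous_continuousOn (ih h.2))

lemma continuousOn {k : ℕ} {f : ℝ → ℂ} (h : ACDiff k f) : ContinuousOn f (Icc 0 1) :=
  absolutelyContinuous_continuousOn h.ac

lemma congr {k : ℕ} {f g : ℝ → ℂ} (hf : ACDiff k f) (h : EqOn f g (Icc 0 1)) : ACDiff k g := by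
  induction k generalizing f g with
  | zero => exact absolutelyContinuous_congr hf h
  | succ k ih =>
    refine ⟨hf.1.congr fun x hx => (h hx).symm, ih hf.2 fun x hx => ?_⟩
    exact derivWithin_congr (fun y hy => h hy) (h hx)

lemma pred {k : ℕ} {f : ℝ → ℂ} (h : ACDiff (k + 1) f) : ACDiff k f := by
  induction k generalizing f with
  | zero => exact h.ac
  | succ k ih => exact ⟨h.1, ih h.2⟩

lemma mono {j k : ℕ} {f : ℝ → ℂ} (h : ACDiff k f) (hjk : j ≤ k) : ACDiff j f := by
  induction hjk with
  | refl => exact h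
  | step _ ih => exact ih h.pred

lemma add {k : ℕ} {f g : ℝ → ℂ} (hf : ACDiff k f) (hg : ACDiff k g) :
    ACDiff k (fun x => f x + g x) := by
  induction k generalizing f g with
  | zero => exact AbsolutelyContinuousOnInterval.fun_add hf hg
  | succ k ih =>
    refine ⟨hf.1.add hg.1, (ih hf.2 hg.2).congr fun x hx => ?_⟩
    exact (derivWithin_fun_add (hf.1 x hx) (hg.1 x hx)).symm

lemma mul {k : ℕ} {f g : ℝ → ℂ} (hf : ACDiff k f) (hg : ACDiff k g) :
    ACDiff k (fun x => f x * g x) := by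
  induction k generalizing f g with
  | zero => exact absolutelyContinuous_mul hf hg
  | succ k ih =>
    refine ⟨hf.1.mul hg.1, ((ih hf.2 hg.pred).add (ih hf.pred hg.2)).congr fun x hx => ?_⟩
    exact (derivWithin_fun_mul (hf.1 x hx) (hg.1 x hx)).symm

lemma const (k : ℕ) (c : ℂ) : ACDiff k (fun _ => c) := by
  induction k generalizing c with
  | zero =>
    exact absolutelyContinuous_of_hasDerivWithinAt (fun x _ => hasDerivWithinAt_const _ _ _)
      continuousOn_const
  | succ k ih =>
    refine ⟨differentiableOn_const c, (ih 0).congr fun x _ => ?_⟩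
    simp

lemma const_mul {k : ℕ} {f : ℝ → ℂ} (c : ℂ) (hf : ACDiff k f) : ACDiff k (fun x => c * f x) :=
  (const k c).mul hf

lemma neg {k : ℕ} {f : ℝ → ℂ} (hf : ACDiff k f) : ACDiff k (fun x => -f x) :=
  (hf.const_mul (-1)).congr fun x _ => by simp

lemma sub {k : ℕ} {f g : ℝ → ℂ} (hf : ACDiff k f) (hg : ACDiff k g) :
    ACDiff k (fun x => f x - g x) :=
  (hf.add hg.neg).congr fun x _ => by simp [sub_eq_add_neg]

lemma sum {ι : Type*} {k : ℕ} {f : ι → ℝ → ℂ} (s : Finset ι) (hf : ∀ i ∈ s, ACDiff k (f i)) :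
    ACDiff k (fun x => ∑ i ∈ s, f i x) := by
  classical
  induction s using Finset.induction_on with
  | empty => simpa using const k 0
  | insert i s hi ih =>
    refine ((hf i (Finset.mem_insert_self i s)).add
      (ih fun j hj => hf j (Finset.mem_insert_of_mem hj))).congr fun x _ => ?_
    rw [Finset.sum_insert hi]

lemma of_sobolevW1 {k : ℕ} {f : ℝ → ℂ} (h : SobolevW1 (k + 1) f) : ACDiff k f := by
  induction k generalizing f with
  | zero =>
    have h0 := h.2.1 0 (by norm_num)
    rwa [iteratedDerivWithin_zero] at h0
  | succ k ih =>
    refine ⟨by simpa [iteratedDerivWithin_zero] using h.1 0 (by omega), ih ⟨?_, ?_, ?_⟩⟩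
    · intro j hj
      rw [← iteratedDerivWithin_succ']
      exact h.1 (j + 1) (by omega)
    · intro j hj
      rw [← iteratedDerivWithin_succ']
      exact h.2.1 (j + 1) (by omega)
    · rw [← iteratedDerivWithin_succ']
      exact h.2.2

end ACDiff

/-! ### The functions `σ_k` -/

lemma sigma_one (p m : ℝ → ℂ) : sigma p m 1 = m := by rw [sigma]

lemma sigma_succ (p m : ℝ → ℂ) {k : ℕ} (hk : 1 ≤ k) (x : ℝ) :
    sigma p m (k + 1) x = -derivWithin (sigma p m k) (Icc 0 1) x
      - p x * ∑ j ∈ Finset.Icc 1 (k - 1), sigma p m j x * sigma p m (k - j) x := by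
  obtain ⟨k, rfl⟩ : ∃ l, k = l + 1 := ⟨k - 1, by omega⟩
  rw [sigma]
  dsimp only
  congr 2
  rw [Fin.sum_univ_eq_sum_range (fun j => sigma p m (j + 1) x * sigma p m (k - j) x)]
  refine Finset.sum_bij (fun j _ => j + 1) ?_ ?_ ?_ ?_
  · intro j hj
    simp only [Finset.mem_range, Finset.mem_Icc] at hj ⊢
    omega
  · intro i _ j _ h
    simpa using h
  · intro j hj
    simp only [Finset.mem_Icc] at hj
    exact ⟨j - 1, by simp only [Finset.mem_range]; omega, by omega⟩
  · intro j _
    congr 2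
    omega

/-- Each step of the recursion costs one derivative, and the quadratic terms involve only smoother
functions. The last function, `k = l + 1`, is merely absolutely continuous, so its derivative is
only an `L¹` function. -/
lemma sigma_acDiff {p m : ℝ → ℂ} {l : ℕ} (hp : ACDiff l p) (hm : ACDiff l m) :
    ∀ k, 1 ≤ k → k ≤ l + 1 → ACDiff (l + 1 - k) (sigma p m k) := by
  intro k
  induction k using Nat.strong_induction_on with
  | _ k ih =>
    intro h1 h2
    rcases Nat.lt_or_ge 1 k with hk | hk
    · obtain ⟨k, rfl⟩ : ∃ i, k = i + 1 := ⟨k - 1, by omega⟩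
      have hd : ACDiff (l + 1 - (k + 1) + 1) (sigma p m k) :=
        (ih k (by omega) (by omega) (by omega)).mono (by omega)
      refine (hd.2.neg.sub ((hp.mono (by omega)).mul (ACDiff.sum (Finset.Icc 1 (k - 1))
        (f := fun j x => sigma p m j x * sigma p m (k - j) x) fun j hj => ?_))).congr
        fun x _ => (sigma_succ p m (by omega) x).symm
      rw [Finset.mem_Icc] at hj
      exact ((ih j (by omega) (by omega) (by omega)).mono (by omega)).mul
        ((ih (k - j) (by omega) (by omega) (by omega)).mono (by omega))
    · obtain rfl : k = 1 := by omega
      rw [sigma_one]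
      exact hm

/-! ### Linear systems with continuous coefficients -/

/-- `(y₁, y₂)` solves `y₁' = μ₁ y₁ + p y₂`, `y₂' = m y₁ + μ₂ y₂` on `[0,1]`. -/
def Solves (μ₁ μ₂ : ℂ) (p m y₁ y₂ : ℝ → ℂ) : Prop :=
  ∀ x ∈ Icc (0 : ℝ) 1,
    HasDerivWithinAt y₁ (μ₁ * y₁ x + p x * y₂ x) (Icc 0 1) x ∧
    HasDerivWithinAt y₂ (m x * y₁ x + μ₂ * y₂ x) (Icc 0 1) x

/-- The Picard iterates of the linear equation `y' = A y`. -/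
noncomputable def picardTerm (A : ℝ → (ℂ × ℂ) →L[ℂ] (ℂ × ℂ)) (v : ℂ × ℂ) : ℕ → ℝ → ℂ × ℂ
  | 0 => fun _ => v
  | n + 1 => fun x => ∫ t in (0 : ℝ)..x, A t (picardTerm A v n t)

lemma picardTerm_continuous {A : ℝ → (ℂ × ℂ) →L[ℂ] (ℂ × ℂ)} (hA : Continuous A) (v : ℂ × ℂ)
    (n : ℕ) : Continuous (picardTerm A v n) := by
  induction n with
  | zero => exact continuous_const
  | succ n ih =>
    have hi : ∀ a b, IntervalIntegrable (fun t => A t (picardTerm A v n t)) volume a b :=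
      fun a b => (hA.clm_apply ih).intervalIntegrable a b
    exact intervalIntegral.continuous_primitive hi 0

lemma picardTerm_hasDerivAt {A : ℝ → (ℂ × ℂ) →L[ℂ] (ℂ × ℂ)} (hA : Continuous A) (v : ℂ × ℂ)
    (n : ℕ) (x : ℝ) : HasDerivAt (picardTerm A v (n + 1)) (A x (picardTerm A v n x)) x :=
  ((hA.clm_apply (picardTerm_continuous hA v n)).integral_hasStrictDerivAt 0 x).hasDerivAt

lemma picardTerm_norm_le {A : ℝ → (ℂ × ℂ) →L[ℂ] (ℂ × ℂ)} {K : ℝ}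
    (hK : ∀ t ∈ Icc (-2 : ℝ) 2, ‖A t‖ ≤ K) (v : ℂ × ℂ) (n : ℕ) :
    ∀ x ∈ Icc (-2 : ℝ) 2, ‖picardTerm A v n x‖ ≤ K ^ n * ‖v‖ / n.factorial * |x - 0| ^ n := by
  have hK0 : 0 ≤ K := (norm_nonneg _).trans (hK 0 (by norm_num))
  induction n with
  | zero => intro x _; simp [picardTerm]
  | succ n ih =>
    intro x hx
    have hsub : uIoc 0 x ⊆ Icc (-2 : ℝ) 2 :=
      uIoc_subset_uIcc.trans (uIcc_subset_Icc (by norm_num) hx)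
    calc ‖picardTerm A v (n + 1) x‖
        ≤ ∫ t in uIoc 0 x, K * (K ^ n * ‖v‖ / n.factorial) * |t - 0| ^ n := by
          refine (intervalIntegral.norm_integral_eq_norm_integral_uIoc _).le.trans ?_
          refine norm_integral_le_of_norm_le ?_ ?_
          · exact (Continuous.integrableOn_uIoc (by fun_prop))
          · refine (ae_restrict_iff' measurableSet_uIoc).2 (Eventually.of_forall fun t ht => ?_)
            rw [mul_assoc]
            exact ((A t).le_opNorm _).trans (mul_le_mul (hK t (hsub ht)) (ih t (hsub ht))
              (norm_nonneg _) hK0)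
      _ = K ^ (n + 1) * ‖v‖ / (n + 1).factorial * |x - 0| ^ (n + 1) := by
          rw [integral_const_mul, integral_pow_abs_sub_uIoc, Nat.factorial_succ]
          push_cast
          field_simp
          ring

/-- The Picard series is dominated by an exponential series, as is the series of its derivatives.
The work is done on `(-2, 2)` because termwise differentiation needs an open set, and this one
contains both endpoints of `[0,1]`. -/
lemma exists_hasDerivAt_linear {A : ℝ → (ℂ × ℂ) →L[ℂ] (ℂ × ℂ)} (hA : Continuous A) (v : ℂ × ℂ) :
    ∃ y : ℝ → ℂ × ℂ, y 0 = v ∧ ∀ x ∈ Icc (0 : ℝ) 1, HasDerivAt y (A x (y x)) x := by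
  obtain ⟨K, hK⟩ := (isCompact_Icc (a := (-2 : ℝ)) (b := 2)).exists_bound_of_continuousOn
    hA.continuousOn
  have hK0 : 0 ≤ K := (norm_nonneg _).trans (hK 0 (by norm_num))
  have hb : ∀ n, ∀ x ∈ Ioo (-2 : ℝ) 2,
      ‖picardTerm A v n x‖ ≤ (2 * K) ^ n / n.factorial * ‖v‖ := by
    intro n x hx
    refine (picardTerm_norm_le hK v n x (Ioo_subset_Icc_self hx)).trans ?_
    have : |x - 0| ^ n ≤ 2 ^ n :=
      pow_le_pow_left₀ (abs_nonneg _) (by rw [sub_zero]; exact abs_le.2 ⟨hx.1.le, hx.2.le⟩) n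
    calc K ^ n * ‖v‖ / n.factorial * |x - 0| ^ n ≤ K ^ n * ‖v‖ / n.factorial * 2 ^ n := by gcongr
      _ = _ := by rw [mul_pow]; ring
  have hs : Summable fun n : ℕ => (2 * K) ^ n / n.factorial * ‖v‖ :=
    (Real.summable_pow_div_factorial (2 * K)).mul_right _
  have hsum : ∀ x ∈ Ioo (-2 : ℝ) 2, Summable fun n => picardTerm A v n x := fun x hx =>
    .of_norm_bounded hs fun n => hb n x hx
  refine ⟨fun x => ∑' n, picardTerm A v n x, ?_, fun x hx => ?_⟩
  · dsimp only
    rw [tsum_eq_single 0]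
    · rfl
    · intro n hn
      obtain ⟨n, rfl⟩ := Nat.exists_eq_succ_of_ne_zero hn
      simp [picardTerm]
  · have hx' : x ∈ Ioo (-2 : ℝ) 2 := ⟨by linarith [hx.1], by linarith [hx.2]⟩
    -- The derivatives are the Picard terms shifted by one index and multiplied by `A`, preceded by
    -- `0`, so that their sum is `A` applied to the original series.
    let g' : ℕ → ℝ → ℂ × ℂ := fun n x => Nat.casesOn n 0 fun k => A x (picardTerm A v k x)
    let u : ℕ → ℝ := fun n => Nat.casesOn n 0 fun k => K * ((2 * K) ^ k / k.factorial * ‖v‖)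
    have hu : Summable u := (summable_nat_add_iff 1).1 (hs.mul_left K)
    have hd := hasDerivAt_tsum_of_isPreconnected (g := picardTerm A v) (g' := g') (y₀ := x) (y := x)
      hu isOpen_Ioo isPreconnected_Ioo ?_ ?_ hx' (hsum x hx') hx'
    · convert! hd using 1
      have hs' : Summable fun n => g' n x :=
        (summable_nat_add_iff 1).1 ((A x).summable (hsum x hx'))
      rw [hs'.tsum_eq_zero_add, (A x).map_tsum (hsum x hx')]
      simp [g']
    · rintro (_ | n) y hy
      · exact hasDerivAt_const _ _
      · exact picardTerm_hasDerivAt hA v n y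
    · rintro (_ | n) y hy
      · simp [g', u]
      · exact ((A y).le_opNorm _).trans (mul_le_mul (hK y (Ioo_subset_Icc_self hy)) (hb n y hy)
          (norm_nonneg _) hK0)

lemma Solves.exists {p m : ℝ → ℂ} (hp : ContinuousOn p (Icc 0 1)) (hm : ContinuousOn m (Icc 0 1))
    (μ₁ μ₂ v₁ v₂ : ℂ) : ∃ y₁ y₂, Solves μ₁ μ₂ p m y₁ y₂ ∧ y₁ 0 = v₁ ∧ y₂ 0 = v₂ := by
  have h01 : (0 : ℝ) ≤ 1 := zero_le_one
  -- The coefficients are extended by their endpoint values, so that `A` is continuous on all of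
  -- `ℝ`.
  let P := IccExtend h01 ((Icc (0 : ℝ) 1).domRestrict p)
  let M := IccExtend h01 ((Icc (0 : ℝ) 1).domRestrict m)
  have hP : Continuous P := (continuousOn_iff_continuous_domRestrict.1 hp).Icc_extend'
  have hM : Continuous M := (continuousOn_iff_continuous_domRestrict.1 hm).Icc_extend'
  let F := ContinuousLinearMap.fst ℂ ℂ ℂ
  let S := ContinuousLinearMap.snd ℂ ℂ ℂ
  let A : ℝ → (ℂ × ℂ) →L[ℂ] (ℂ × ℂ) := fun t =>
    (μ₁ • F).prod (μ₂ • S) + P t • S.prod 0 + M t • (0 : (ℂ × ℂ) →L[ℂ] ℂ).prod F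
  have hA : Continuous A := by fun_prop
  obtain ⟨y, hy0, hy⟩ := exists_hasDerivAt_linear hA (v₁, v₂)
  refine ⟨fun x => (y x).1, fun x => (y x).2, fun x hx => ?_, by simp [hy0], by simp [hy0]⟩
  have e1 : P x = p x := IccExtend_of_mem h01 _ hx
  have e2 : M x = m x := IccExtend_of_mem h01 _ hx
  have hd := hy x hx
  have e : A x (y x) = (μ₁ * (y x).1 + p x * (y x).2, m x * (y x).1 + μ₂ * (y x).2) := by
    apply Prod.ext <;> simp [A, F, S, e1, e2, add_comm]
  rw [e] at hd
  have h1 := hd.hasFDerivAt.fst.hasDerivAt.hasDerivWithinAt (s := Icc 0 1)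
  have h2 := hd.hasFDerivAt.snd.hasDerivAt.hasDerivWithinAt (s := Icc 0 1)
  simp only [ContinuousLinearMap.comp_apply, ContinuousLinearMap.toSpanSingleton_apply,
    one_smul, ContinuousLinearMap.coe_fst', ContinuousLinearMap.coe_snd'] at h1 h2
  exact ⟨h1, h2⟩

namespace Solves

variable {μ₁ μ₂ : ℂ} {p m y₁ y₂ : ℝ → ℂ}

lemma continuousOn_fst (h : Solves μ₁ μ₂ p m y₁ y₂) : ContinuousOn y₁ (Icc 0 1) :=
  fun x hx => (h x hx).1.continuousWithinAt

lemma continuousOn_snd (h : Solves μ₁ μ₂ p m y₁ y₂) : ContinuousOn y₂ (Icc 0 1) :=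
  fun x hx => (h x hx).2.continuousWithinAt

lemma ac_fst (h : Solves μ₁ μ₂ p m y₁ y₂) (hp : ContinuousOn p (Icc 0 1)) :
    AbsolutelyContinuousOnInterval y₁ 0 1 :=
  absolutelyContinuous_of_hasDerivWithinAt (fun x hx => (h x hx).1)
    ((continuousOn_const.mul h.continuousOn_fst).add (hp.mul h.continuousOn_snd))

lemma ac_snd (h : Solves μ₁ μ₂ p m y₁ y₂) (hm : ContinuousOn m (Icc 0 1)) :
    AbsolutelyContinuousOnInterval y₂ 0 1 :=
  absolutelyContinuous_of_hasDerivWithinAt (fun x hx => (h x hx).2)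
    ((hm.mul h.continuousOn_fst).add (continuousOn_const.mul h.continuousOn_snd))

end Solves

/-! ### Equivalence of the Dirac system in `W_1^1` with a first order system holding at every point
-/

lemma sobolevW1_one_of_hasDerivWithinAt {f f' : ℝ → ℂ}
    (hf : ∀ x ∈ Icc (0 : ℝ) 1, HasDerivWithinAt f (f' x) (Icc 0 1) x)
    (hf' : ContinuousOn f' (Icc 0 1)) : SobolevW1 1 f := by
  refine ⟨fun k hk => by omega, fun k hk => ?_, ?_⟩
  · obtain rfl : k = 0 := by omega
    rw [iteratedDerivWithin_zero]
    exact absolutelyContinuous_of_hasDerivWithinAt hf hf'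
  · rw [iteratedDerivWithin_one]
    refine (hf'.congr fun x hx => ?_).integrableOn_Icc
    exact (hf x hx).derivWithin (uniqueDiffWithinAt_unitInterval hx)

/-- An absolutely continuous function is the integral of its derivative. Replacing that derivative
under the integral by a continuous function equal to it almost everywhere makes the equation hold at
every point. -/
lemma hasDerivWithinAt_of_ac {f f' : ℝ → ℂ} (hf : AbsolutelyContinuousOnInterval f 0 1)
    (hf' : ContinuousOn f' (Icc 0 1))
    (h : ∀ᵐ x ∂(volume.restrict (Icc (0 : ℝ) 1)), deriv f x = f' x) :
    ∀ x ∈ Icc (0 : ℝ) 1, HasDerivWithinAt f (f' x) (Icc 0 1) x := by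
  have h01 : (0 : ℝ) ≤ 1 := zero_le_one
  let G := IccExtend h01 ((Icc (0 : ℝ) 1).domRestrict f')
  have hG : Continuous G := (continuousOn_iff_continuous_domRestrict.1 hf').Icc_extend'
  have hGf : ∀ x ∈ Icc (0 : ℝ) 1, G x = f' x := fun x hx => IccExtend_of_mem h01 _ hx
  have key : ∀ x ∈ Icc (0 : ℝ) 1, f x = f 0 + ∫ t in (0 : ℝ)..x, G t := by
    intro x hx
    have hx' : uIcc 0 x ⊆ uIcc (0 : ℝ) 1 := by
      rw [uIcc_of_le hx.1, uIcc_of_le h01]; exact Icc_subset_Icc_right hx.2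
    have e := absolutelyContinuous_integral_deriv (hf.mono hx')
    have e' : ∫ t in (0 : ℝ)..x, deriv f t = ∫ t in (0 : ℝ)..x, G t := by
      refine intervalIntegral.integral_congr_ae ?_
      filter_upwards [(ae_restrict_iff' measurableSet_Icc).1 h] with t ht ht'
      have htm : t ∈ Icc (0 : ℝ) 1 := by
        have := hx' (uIoc_subset_uIcc ht')
        rwa [uIcc_of_le h01] at this
      rw [ht htm, hGf t htm]
    rw [← e', e]
    ring
  intro x hx
  have hd : HasDerivAt (fun x => f 0 + ∫ t in (0 : ℝ)..x, G t) (G x) x :=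
    (hG.integral_hasStrictDerivAt 0 x).hasDerivAt.const_add _
  rw [hGf x hx] at hd
  exact hd.hasDerivWithinAt.congr (fun y hy => key y hy) (key x hx)

lemma matB_inv (b₁ b₂ : ℝ) (h₁ : b₁ ≠ 0) (h₂ : b₂ ≠ 0) :
    (matB b₁ b₂)⁻¹ = !![((b₁ : ℂ))⁻¹, 0; 0, ((b₂ : ℂ))⁻¹] := by
  refine Matrix.inv_eq_left_inv ?_
  have h₁' : (b₁ : ℂ) ≠ 0 := by exact_mod_cast h₁
  have h₂' : (b₂ : ℂ) ≠ 0 := by exact_mod_cast h₂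
  simp [matB, Matrix.one_fin_two, h₁', h₂']

lemma system_iff {b₁ b₂ : ℝ} (h₁ : b₁ ≠ 0) (h₂ : b₂ ≠ 0) (Q₁₂ Q₂₁ : ℝ → ℂ) (z : ℂ) (x : ℝ)
    (d y : Fin 2 → ℂ) :
    (-Complex.I) • ((matB b₁ b₂)⁻¹.mulVec d) + (potential Q₁₂ Q₂₁ x).mulVec y = z • y ↔
      d 0 = Complex.I * b₁ * z * y 0 + qPlus b₁ Q₁₂ x * y 1 ∧
      d 1 = qMinus b₂ Q₂₁ x * y 0 + Complex.I * b₂ * z * y 1 := by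
  have h₁' : (b₁ : ℂ) ≠ 0 := by exact_mod_cast h₁
  have h₂' : (b₂ : ℂ) ≠ 0 := by exact_mod_cast h₂
  rw [matB_inv b₁ b₂ h₁ h₂, funext_iff, Fin.forall_fin_two]
  simp only [potential, qPlus, qMinus, Matrix.mulVec, dotProduct, Fin.sum_univ_two, Pi.add_apply,
    Pi.smul_apply, smul_eq_mul, Matrix.of_apply, Matrix.cons_val', Matrix.cons_val_zero,
    Matrix.cons_val_one, Matrix.cons_val_fin_one, zero_mul, add_zero, zero_add]
  have hI := Complex.I_sq
  refine and_congr ⟨fun h => ?_, fun h => ?_⟩ ⟨fun h => ?_, fun h => ?_⟩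
  · linear_combination (Complex.I * b₁) * h + b₁ * (b₁ : ℂ)⁻¹ * d 0 * hI
      - d 0 * mul_inv_cancel₀ h₁'
  · rw [h]
    field_simp
    linear_combination (-(z * y 0) + Q₁₂ x * y 1) * hI
  · linear_combination (Complex.I * b₂) * h + b₂ * (b₂ : ℂ)⁻¹ * d 1 * hI
      - d 1 * mul_inv_cancel₀ h₂'
  · rw [h]
    field_simp
    linear_combination (-(z * y 1) + Q₂₁ x * y 0) * hI

lemma isSolution_iff {b₁ b₂ : ℝ} (h₁ : b₁ ≠ 0) (h₂ : b₂ ≠ 0) {Q₁₂ Q₂₁ : ℝ → ℂ}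
    (hp : ContinuousOn (qPlus b₁ Q₁₂) (Icc 0 1)) (hm : ContinuousOn (qMinus b₂ Q₂₁) (Icc 0 1))
    (z : ℂ) (y : ℝ → Fin 2 → ℂ) :
    IsSolution b₁ b₂ Q₁₂ Q₂₁ z y ↔
      Solves (Complex.I * b₁ * z) (Complex.I * b₂ * z) (qPlus b₁ Q₁₂) (qMinus b₂ Q₂₁)
        (fun x => y x 0) (fun x => y x 1) := by
  constructor
  · rintro ⟨hW, hae⟩
    have hac : ∀ j, AbsolutelyContinuousOnInterval (fun x => y x j) 0 1 := fun j => by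
      have := (hW j).2.1 0 one_pos
      rwa [iteratedDerivWithin_zero] at this
    have hc := fun j => absolutelyContinuous_continuousOn (hac j)
    intro x hx
    refine ⟨hasDerivWithinAt_of_ac (f' := fun x => _ * y x 0 + qPlus b₁ Q₁₂ x * y x 1) (hac 0)
      ((continuousOn_const.mul (hc 0)).add (hp.mul (hc 1))) ?_ x hx,
      hasDerivWithinAt_of_ac (f' := fun x => qMinus b₂ Q₂₁ x * y x 0 + _ * y x 1) (hac 1)
      ((hm.mul (hc 0)).add (continuousOn_const.mul (hc 1))) ?_ x hx⟩
    · filter_upwards [hae] with t ht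
      exact ((system_iff h₁ h₂ Q₁₂ Q₂₁ z t _ _).1 ht).1
    · filter_upwards [hae] with t ht
      exact ((system_iff h₁ h₂ Q₁₂ Q₂₁ z t _ _).1 ht).2
  · intro h
    refine ⟨?_, ?_⟩
    · rw [Fin.forall_fin_two]
      exact ⟨sobolevW1_one_of_hasDerivWithinAt (fun x hx => (h x hx).1)
        ((continuousOn_const.mul h.continuousOn_fst).add (hp.mul h.continuousOn_snd)),
        sobolevW1_one_of_hasDerivWithinAt (fun x hx => (h x hx).2)
        ((hm.mul h.continuousOn_fst).add (continuousOn_const.mul h.continuousOn_snd))⟩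
    · rw [← restrict_Ioo_eq_restrict_Icc, ae_restrict_iff' measurableSet_Ioo]
      refine Eventually.of_forall fun x hx => ?_
      have hn : Icc (0 : ℝ) 1 ∈ 𝓝 x := Icc_mem_nhds hx.1 hx.2
      have hx' := Ioo_subset_Icc_self hx
      rw [system_iff h₁ h₂]
      exact ⟨((h x hx').1.hasDerivAt hn).deriv, ((h x hx').2.hasDerivAt hn).deriv⟩

lemma exists_isFundamentalMatrix {b₁ b₂ : ℝ} (h₁ : b₁ ≠ 0) (h₂ : b₂ ≠ 0) {Q₁₂ Q₂₁ : ℝ → ℂ}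
    (hp : ContinuousOn (qPlus b₁ Q₁₂) (Icc 0 1)) (hm : ContinuousOn (qMinus b₂ Q₂₁) (Icc 0 1)) :
    ∃ Φ : ℂ → ℝ → Matrix (Fin 2) (Fin 2) ℂ, IsFundamentalMatrix b₁ b₂ Q₁₂ Q₂₁ Φ := by
  choose u v h using fun (z : ℂ) (k : Fin 2) => Solves.exists hp hm (Complex.I * b₁ * z)
    (Complex.I * b₂ * z) ((1 : Matrix (Fin 2) (Fin 2) ℂ) 0 k) ((1 : Matrix (Fin 2) (Fin 2) ℂ) 1 k)
  refine ⟨fun z x => Matrix.of ![fun k => u z k x, fun k => v z k x], fun z => ⟨?_, fun k => ?_⟩⟩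
  · ext i k
    fin_cases i
    · exact (h z k).2.1
    · exact (h z k).2.2
  · rw [isSolution_iff h₁ h₂ hp hm]
    exact (h z k).1

/-! ### Truncated products of polynomials in a small parameter -/

lemma sum_trunc_eq_sum_filter (a b : ℕ → ℂ) (w : ℂ) {N n : ℕ} (hN : N ≤ n) :
    ∑ k ∈ Finset.Icc 1 N, (∑ j ∈ Finset.Icc 1 (k - 1), a j * b (k - j)) * w ^ k =
      ∑ q ∈ (Finset.Icc 1 n ×ˢ Finset.Icc 1 n).filter (fun q : ℕ × ℕ => q.1 + q.2 ≤ N),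
        a q.1 * w ^ q.1 * (b q.2 * w ^ q.2) := by
  simp_rw [Finset.sum_mul]
  rw [Finset.sum_sigma']
  refine Finset.sum_nbij' (fun s => (s.2, s.1 - s.2)) (fun q => ⟨q.1 + q.2, q.1⟩) ?_ ?_ ?_ ?_ ?_
  · rintro ⟨k, j⟩ h
    simp only [Finset.mem_sigma, Finset.mem_Icc, Finset.mem_filter, Finset.mem_product] at h ⊢
    omega
  · rintro ⟨i, j⟩ h
    simp only [Finset.mem_sigma, Finset.mem_Icc, Finset.mem_filter, Finset.mem_product] at h ⊢
    omega
  · rintro ⟨k, j⟩ h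
    simp only [Finset.mem_sigma, Finset.mem_Icc] at h
    have e : j + (k - j) = k := by omega
    simp only [e]
  · rintro ⟨i, j⟩ _
    simp
  · rintro ⟨k, j⟩ h
    simp only [Finset.mem_sigma, Finset.mem_Icc] at h
    have e : w ^ k = w ^ j * w ^ (k - j) := by rw [← pow_add]; congr 1; omega
    simp only [e]
    ring

/-- What remains of the product are the pairs `(i, j)` with `i + j ≥ N + 1`. There are at most `n²`
of them. -/
lemma norm_sum_mul_sum_sub_trunc_le {a b : ℕ → ℂ} {M : ℝ} {N n : ℕ} (hN : N ≤ n)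
    (ha : ∀ k ∈ Finset.Icc 1 n, ‖a k‖ ≤ M) (hb : ∀ k ∈ Finset.Icc 1 n, ‖b k‖ ≤ M) {w : ℂ}
    (hw : ‖w‖ ≤ 1) :
    ‖(∑ k ∈ Finset.Icc 1 n, a k * w ^ k) * (∑ k ∈ Finset.Icc 1 n, b k * w ^ k)
      - ∑ k ∈ Finset.Icc 1 N, (∑ j ∈ Finset.Icc 1 (k - 1), a j * b (k - j)) * w ^ k‖
      ≤ M ^ 2 * n ^ 2 * ‖w‖ ^ (N + 1) := by
  rw [sum_trunc_eq_sum_filter a b w hN, Finset.sum_mul_sum, ← Finset.sum_product',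
    ← Finset.sum_filter_add_sum_filter_not (Finset.Icc 1 n ×ˢ Finset.Icc 1 n)
      (fun q : ℕ × ℕ => q.1 + q.2 ≤ N), add_sub_cancel_left]
  have hterm : ∀ q ∈ (Finset.Icc 1 n ×ˢ Finset.Icc 1 n).filter
      (fun q : ℕ × ℕ => ¬ q.1 + q.2 ≤ N),
      ‖a q.1 * w ^ q.1 * (b q.2 * w ^ q.2)‖ ≤ M ^ 2 * ‖w‖ ^ (N + 1) := by
    intro q hq
    rw [Finset.mem_filter, Finset.mem_product] at hq
    have h1 := ha _ hq.1.1
    have h2 := hb _ hq.1.2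
    have hM : 0 ≤ M := (norm_nonneg _).trans h1
    calc ‖a q.1 * w ^ q.1 * (b q.2 * w ^ q.2)‖ = ‖a q.1‖ * ‖b q.2‖ * ‖w‖ ^ (q.1 + q.2) := by
          rw [norm_mul, norm_mul, norm_mul, norm_pow, norm_pow, pow_add]; ring
      _ ≤ M * M * ‖w‖ ^ (N + 1) := by
          gcongr ?_ * ?_ * ?_
          exact pow_le_pow_of_le_one (norm_nonneg _) hw (by omega)
      _ = _ := by ring
  rcases Nat.eq_zero_or_pos n with rfl | hn
  · simp
  have hM : 0 ≤ M := (norm_nonneg _).trans (ha 1 (Finset.mem_Icc.2 ⟨le_rfl, hn⟩))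
  calc _ ≤ _ := norm_sum_le_of_le _ hterm
    _ ≤ (n * n : ℕ) * (M ^ 2 * ‖w‖ ^ (N + 1)) := by
        rw [Finset.sum_const, nsmul_eq_mul]
        gcongr
        refine (Finset.card_filter_le _ _).trans ?_
        rw [Finset.card_product, Nat.card_Icc, Nat.add_sub_cancel]
    _ = _ := by push_cast; ring

lemma norm_sum_mul_pow_le {a : ℕ → ℂ} {M : ℝ} {n : ℕ} (ha : ∀ k ∈ Finset.Icc 1 n, ‖a k‖ ≤ M)
    {w : ℂ} (hw : ‖w‖ ≤ 1) : ‖∑ k ∈ Finset.Icc 1 n, a k * w ^ k‖ ≤ n * M * ‖w‖ := by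
  have : ∀ k ∈ Finset.Icc 1 n, ‖a k * w ^ k‖ ≤ M * ‖w‖ := by
    intro k hk
    rw [norm_mul, norm_pow]
    refine mul_le_mul (ha k hk) ?_ (by positivity) ((norm_nonneg _).trans (ha k hk))
    exact pow_le_of_le_one (norm_nonneg _) hw (by rw [Finset.mem_Icc] at hk; omega)
  refine (norm_sum_le_of_le _ this).trans (le_of_eq ?_)
  rw [Finset.sum_const, Nat.card_Icc, Nat.add_sub_cancel, nsmul_eq_mul]
  ring

/-- Multiplication by `ζ = w⁻¹` shifts the index, pairing `s (k + 1)` with `w ^ k`; this is where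
the recursion for `σ_{k+1}` can be inserted. -/
lemma mul_sum_mul_pow (s : ℕ → ℂ) {w ζ : ℂ} (hw : ζ * w = 1) (N : ℕ) :
    ζ * ∑ k ∈ Finset.Icc 1 (N + 1), s k * w ^ k =
      s 1 + ∑ k ∈ Finset.Icc 1 N, s (k + 1) * w ^ k := by
  induction N with
  | zero =>
    simp only [zero_add, Finset.Icc_self, Finset.sum_singleton, pow_one, zero_lt_one,
      Finset.Icc_eq_empty_of_lt, Finset.sum_empty]
    linear_combination s 1 * hw
  | succ N ih =>
    rw [Finset.sum_Icc_succ_top (by omega), mul_add, ih, Finset.sum_Icc_succ_top (by omega)]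
    linear_combination s (N + 1 + 1) * w ^ (N + 1) * hw

/-- The residual of the truncated formal solution of the Riccati equation. -/
lemma riccati_residual_norm_le {s d : ℕ → ℂ} {p : ℂ} {l : ℕ} {M P : ℝ}
    (hs : ∀ k ∈ Finset.Icc 1 (l + 1), ‖s k‖ ≤ M) (hp : ‖p‖ ≤ P)
    (hrec : ∀ k ∈ Finset.Icc 1 l,
      s (k + 1) = -d k - p * ∑ j ∈ Finset.Icc 1 (k - 1), s j * s (k - j))
    {w ζ : ℂ} (hw : ζ * w = 1) (hw1 : ‖w‖ ≤ 1) :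
    ‖s 1 - ζ * (∑ k ∈ Finset.Icc 1 (l + 1), s k * w ^ k)
        - ∑ k ∈ Finset.Icc 1 (l + 1), d k * w ^ k
        - p * (∑ k ∈ Finset.Icc 1 (l + 1), s k * w ^ k) ^ 2‖
      ≤ ‖w‖ ^ (l + 1) * (‖d (l + 1)‖ + P * (M ^ 2 * (l + 1 : ℕ) ^ 2)) := by
  have h1 : ∑ k ∈ Finset.Icc 1 l, s (k + 1) * w ^ k = -∑ k ∈ Finset.Icc 1 l, d k * w ^ k
      - p * ∑ k ∈ Finset.Icc 1 l, (∑ j ∈ Finset.Icc 1 (k - 1), s j * s (k - j)) * w ^ k := by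
    rw [Finset.mul_sum, ← Finset.sum_neg_distrib, ← Finset.sum_sub_distrib]
    refine Finset.sum_congr rfl fun k hk => ?_
    rw [hrec k hk]
    ring
  -- The recursion cancels every power up to `w ^ l`. Only the derivative of the last coefficient
  -- and the tail of the square survive.
  have h2 : s 1 - ζ * (∑ k ∈ Finset.Icc 1 (l + 1), s k * w ^ k)
        - ∑ k ∈ Finset.Icc 1 (l + 1), d k * w ^ k
        - p * (∑ k ∈ Finset.Icc 1 (l + 1), s k * w ^ k) ^ 2 =
      -(d (l + 1) * w ^ (l + 1)) - p * ((∑ k ∈ Finset.Icc 1 (l + 1), s k * w ^ k)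
        * (∑ k ∈ Finset.Icc 1 (l + 1), s k * w ^ k)
        - ∑ k ∈ Finset.Icc 1 l, (∑ j ∈ Finset.Icc 1 (k - 1), s j * s (k - j)) * w ^ k) := by
    rw [mul_sum_mul_pow s hw, h1, Finset.sum_Icc_succ_top (f := fun k => d k * w ^ k) (by omega)]
    ring
  rw [h2]
  refine (norm_sub_le _ _).trans ?_
  rw [norm_neg, norm_mul, norm_mul, norm_pow]
  have h3 := norm_sum_mul_sum_sub_trunc_le (Nat.le_succ l) hs hs hw1
  have h4 := mul_le_mul hp h3 (norm_nonneg _) ((norm_nonneg _).trans hp)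
  linarith

/-! ### Solutions with dominating first component -/

/-- The truncated formal solution of the Riccati equation. -/
noncomputable def formalSum (p m : ℝ → ℂ) (n : ℕ) (w : ℂ) (x : ℝ) : ℂ :=
  ∑ k ∈ Finset.Icc 1 n, sigma p m k x * w ^ k

lemma exists_primitive {h : ℝ → ℂ} (hh : ContinuousOn h (Icc 0 1)) {D : ℝ}
    (hD : ∀ x ∈ Icc (0 : ℝ) 1, ‖h x‖ ≤ D) :
    ∃ H : ℝ → ℂ, H 0 = 0 ∧ (∀ x ∈ Icc (0 : ℝ) 1, HasDerivWithinAt H (h x) (Icc 0 1) x) ∧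
      ∀ x ∈ Icc (0 : ℝ) 1, ‖H x‖ ≤ D := by
  have h01 : (0 : ℝ) ≤ 1 := zero_le_one
  let G := IccExtend h01 ((Icc (0 : ℝ) 1).domRestrict h)
  have hG : Continuous G := (continuousOn_iff_continuous_domRestrict.1 hh).Icc_extend'
  have hd : ∀ x ∈ Icc (0 : ℝ) 1,
      HasDerivWithinAt (fun x => ∫ t in (0 : ℝ)..x, G t) (h x) (Icc 0 1) x := by
    intro x hx
    have := ((hG.integral_hasStrictDerivAt 0 x).hasDerivAt).hasDerivWithinAt (s := Icc 0 1)
    rwa [show G x = h x from IccExtend_of_mem h01 _ hx] at this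
  refine ⟨fun x => ∫ t in (0 : ℝ)..x, G t, by simp, hd, fun x hx => ?_⟩
  have h1 := (convex_Icc (0 : ℝ) 1).norm_image_sub_le_of_norm_hasDerivWithin_le hd hD
    (left_mem_Icc.2 h01) hx
  simp only [intervalIntegral.integral_same, sub_zero, Real.norm_eq_abs, abs_of_nonneg hx.1] at h1
  have hD0 : 0 ≤ D := (norm_nonneg _).trans (hD x hx)
  exact h1.trans (mul_le_of_le_one_right hD0 hx.2)

lemma exists_sigma_bound {p m : ℝ → ℂ} {l : ℕ} (hp : ACDiff l p) (hm : ACDiff l m) :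
    ∃ M : ℝ, 0 ≤ M ∧ ∀ k ∈ Finset.Icc 1 (l + 1), ∀ x ∈ Icc (0 : ℝ) 1, ‖sigma p m k x‖ ≤ M := by
  have h : ∀ k : ℕ, ∃ C : ℝ, 0 ≤ C ∧ (k ∈ Finset.Icc 1 (l + 1) →
      ∀ x ∈ Icc (0 : ℝ) 1, ‖sigma p m k x‖ ≤ C) := by
    intro k
    by_cases hk : k ∈ Finset.Icc 1 (l + 1)
    · have hk' := Finset.mem_Icc.1 hk
      obtain ⟨C, hC⟩ := isCompact_Icc.exists_bound_of_continuousOn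
        (sigma_acDiff hp hm k hk'.1 hk'.2).continuousOn
      exact ⟨C, (norm_nonneg _).trans (hC 0 (by norm_num)), fun _ => hC⟩
    · exact ⟨0, le_rfl, fun h => absurd h hk⟩
  choose C hC0 hC using h
  refine ⟨∑ k ∈ Finset.Icc 1 (l + 1), C k, Finset.sum_nonneg fun k _ => hC0 k, fun k hk x hx => ?_⟩
  exact (hC k hk x hx).trans (Finset.single_le_sum (fun i _ => hC0 i) hk)

lemma formalSum_ac {p m : ℝ → ℂ} {l : ℕ} (hp : ACDiff l p) (hm : ACDiff l m) (w : ℂ) :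
    AbsolutelyContinuousOnInterval (formalSum p m (l + 1) w) 0 1 := by
  refine (ACDiff.sum (k := 0) (f := fun k x => sigma p m k x * w ^ k) _ fun k hk => ?_)
  rw [Finset.mem_Icc] at hk
  exact ((sigma_acDiff hp hm k hk.1 hk.2).mono (Nat.zero_le _)).mul (ACDiff.const 0 _)

lemma ae_differentiableAt_sigma {p m : ℝ → ℂ} {l : ℕ} (hp : ACDiff l p) (hm : ACDiff l m) :
    ∀ᵐ x : ℝ, x ∈ Icc (0 : ℝ) 1 →
      ∀ k ∈ Finset.Icc 1 (l + 1), DifferentiableAt ℝ (sigma p m k) x := by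
  have h : ∀ k : ℕ, ∀ᵐ x : ℝ, k ∈ Finset.Icc 1 (l + 1) → x ∈ Icc (0 : ℝ) 1 →
      DifferentiableAt ℝ (sigma p m k) x := by
    intro k
    by_cases hk : k ∈ Finset.Icc 1 (l + 1)
    · have hk' := Finset.mem_Icc.1 hk
      filter_upwards [absolutelyContinuous_ae_differentiableAt
        (sigma_acDiff hp hm k hk'.1 hk'.2).ac] with x hx _ hx'
      exact hx (by rwa [uIcc_of_le zero_le_one])
    · exact Eventually.of_forall fun x h => absurd h hk
  filter_upwards [ae_all_iff.2 h] with x hx hx' k hk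
  exact hx k hk hx'

/-- The deviation `V = Z - SY` satisfies `V' = -(ζ + pS)V + RY` almost everywhere, with `R` the
Riccati residual; this is integrated with the factor `exp(ζx + Θ)`, `Θ' = pS`. The bound `A` for `Y`
is left free here and is determined in `column_estimate`. -/
lemma exists_deviation_bound {p m : ℝ → ℂ} {l : ℕ} (hp : ACDiff l p) (hm : ACDiff l m) :
    ∃ (C : ℝ) (g : ℝ → ℝ), 0 ≤ C ∧ (∀ x, 0 ≤ g x) ∧ IntervalIntegrable g volume 0 1 ∧
      ∀ ζ : ℂ, 1 ≤ ‖ζ‖ → ∀ Y Z : ℝ → ℂ, Solves 0 (-ζ) p m Y Z → Y 0 = 1 → Z 0 = 0 →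
      ∀ A : ℝ, (∀ x ∈ Icc (0 : ℝ) 1, ‖Y x‖ ≤ A) → ∀ x ∈ Icc (0 : ℝ) 1,
      ‖Z x - formalSum p m (l + 1) ζ⁻¹ x * Y x‖ ≤ C * Real.exp (-(ζ.re * x)) * ‖ζ⁻¹‖
        + C * A * ‖ζ⁻¹‖ ^ (l + 1) * ∫ t in (0 : ℝ)..x, Real.exp (-(ζ.re * (x - t))) * g t := by
  obtain ⟨P, hP⟩ := isCompact_Icc.exists_bound_of_continuousOn hp.continuousOn
  obtain ⟨M, hM0, hM⟩ := exists_sigma_bound hp hm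
  have hP0 : 0 ≤ P := (norm_nonneg _).trans (hP 0 (by norm_num))
  set D : ℝ := P * ((l + 1 : ℕ) * M) with hDdef
  have hD0 : 0 ≤ D := by positivity
  set E : ℝ := Real.exp D with hEdef
  have hE0 : 0 ≤ E := (Real.exp_pos _).le
  set N : ℝ := (l + 1 : ℕ) * M with hNdef
  have hN0 : 0 ≤ N := by positivity
  have hl := sigma_acDiff hp hm (l + 1) (by omega) le_rfl
  -- This is the coefficient of `‖w‖ ^ (l + 1)` in the bound for the Riccati residual. It does not
  -- depend on `ζ`.
  set g : ℝ → ℝ := fun x => ‖deriv (sigma p m (l + 1)) x‖ + P * (M ^ 2 * (l + 1 : ℕ) ^ 2) with hg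
  have hgint : IntervalIntegrable g volume 0 1 :=
    (absolutelyContinuous_intervalIntegrable_deriv hl.ac).norm.add intervalIntegrable_const
  refine ⟨E * N + E * E, g, by positivity, fun x => by positivity, hgint, ?_⟩
  intro ζ hζ Y Z hS hY0 hZ0 A hA x hx
  set w := ζ⁻¹ with hw
  have hζ0 : ζ ≠ 0 := by rintro rfl; norm_num at hζ
  have hζw : ζ * w = 1 := mul_inv_cancel₀ hζ0
  have hw1 : ‖w‖ ≤ 1 := by rw [hw, norm_inv]; exact inv_le_one_of_one_le₀ hζ
  have hA0 : 0 ≤ A := (norm_nonneg _).trans (hA x hx)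
  set S := formalSum p m (l + 1) w with hSdef
  have hSac : AbsolutelyContinuousOnInterval S 0 1 := formalSum_ac hp hm w
  have hSb : ∀ t ∈ Icc (0 : ℝ) 1, ‖S t‖ ≤ N * ‖w‖ := fun t ht =>
    norm_sum_mul_pow_le (fun k hk => hM k hk t ht) hw1
  have hpS : ∀ t ∈ Icc (0 : ℝ) 1, ‖p t * S t‖ ≤ D := by
    intro t ht
    rw [norm_mul]
    exact mul_le_mul (hP t ht) ((hSb t ht).trans (mul_le_of_le_one_right hN0 hw1))
      (norm_nonneg _) hP0
  have hpSc : ContinuousOn (fun t => p t * S t) (Icc 0 1) :=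
    hp.continuousOn.mul (absolutelyContinuous_continuousOn hSac)
  obtain ⟨Θ, hΘ0, hΘ, hΘb⟩ := exists_primitive hpSc hpS
  have hEd : ∀ t ∈ Icc (0 : ℝ) 1, HasDerivWithinAt (fun t : ℝ => Complex.exp (ζ * t + Θ t))
      (Complex.exp (ζ * t + Θ t) * (ζ + p t * S t)) (Icc 0 1) t := by
    intro t ht
    have h1 : HasDerivWithinAt (fun t : ℝ => ζ * (t : ℂ)) (ζ * 1) (Icc 0 1) t :=
      (Complex.ofRealCLM.hasDerivAt.const_mul ζ).hasDerivWithinAt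
    rw [mul_one] at h1
    exact (h1.add (hΘ t ht)).cexp
  have hΘc : ContinuousOn Θ (Icc 0 1) := fun t ht => (hΘ t ht).continuousWithinAt
  have hEc : ContinuousOn (fun t : ℝ => Complex.exp (ζ * t + Θ t)) (Icc 0 1) :=
    fun t ht => (hEd t ht).continuousWithinAt
  have hEac := absolutelyContinuous_of_hasDerivWithinAt hEd
    (hEc.mul (continuousOn_const.add hpSc))
  have hYac := hS.ac_fst hp.continuousOn
  have hZac := hS.ac_snd hm.continuousOn
  set F : ℝ → ℂ := fun t => Complex.exp (ζ * t + Θ t) * (Z t - S t * Y t) with hF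
  have hFac : AbsolutelyContinuousOnInterval F 0 1 :=
    absolutelyContinuous_mul hEac (hZac.fun_sub (absolutelyContinuous_mul hSac hYac))
  have hxs : uIcc 0 x ⊆ uIcc (0 : ℝ) 1 := by
    rw [uIcc_of_le hx.1, uIcc_of_le zero_le_one]; exact Icc_subset_Icc_right hx.2
  have hexp : ∀ t ∈ Icc (0 : ℝ) 1,
      ‖Complex.exp (ζ * t + Θ t)‖ ≤ Real.exp (ζ.re * t) * E := by
    intro t ht
    rw [Complex.norm_exp, ← Real.exp_add, Real.exp_le_exp]
    have := (Complex.re_le_norm (Θ t)).trans (hΘb t ht)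
    simpa using this
  have hFd : ∀ᵐ t : ℝ, t ∈ Ioc 0 x →
      ‖deriv F t‖ ≤ Real.exp (ζ.re * t) * (E * A * ‖w‖ ^ (l + 1) * g t) := by
    -- Without the right endpoint, `[0,1]` is a neighbourhood of `t`, and one-sided derivatives
    -- become ordinary ones.
    have hne : ∀ᵐ t : ℝ, t ≠ 1 := by simp [ae_iff]
    filter_upwards [ae_differentiableAt_sigma hp hm, hne] with t ht1 ht2 ht3
    have ht : t ∈ Icc (0 : ℝ) 1 := ⟨ht3.1.le, ht3.2.trans hx.2⟩
    have hn : Icc (0 : ℝ) 1 ∈ 𝓝 t := Icc_mem_nhds ht3.1 (lt_of_le_of_ne ht.2 ht2)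
    have hSd : HasDerivAt S (∑ k ∈ Finset.Icc 1 (l + 1), deriv (sigma p m k) t * w ^ k) t :=
      HasDerivAt.fun_sum fun k hk => ((ht1 ht k hk).hasDerivAt).mul_const (w ^ k)
    have hYd := (hS t ht).1.hasDerivAt hn
    have hZd := (hS t ht).2.hasDerivAt hn
    have hd := ((hEd t ht).hasDerivAt hn).mul (hZd.sub (hSd.mul hYd))
    have hrec : ∀ k ∈ Finset.Icc 1 l, sigma p m (k + 1) t = -deriv (sigma p m k) t
        - p t * ∑ j ∈ Finset.Icc 1 (k - 1), sigma p m j t * sigma p m (k - j) t := by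
      intro k hk
      rw [sigma_succ p m (Finset.mem_Icc.1 hk).1, derivWithin_of_mem_nhds hn]
    have hR := riccati_residual_norm_le (s := fun k => sigma p m k t)
      (d := fun k => deriv (sigma p m k) t) (fun k hk => hM k hk t ht) (hP t ht) hrec hζw hw1
    rw [show deriv F t = _ from hd.deriv]
    simp only [sigma_one] at hR
    change ‖m t - ζ * S t - _ - p t * S t ^ 2‖ ≤ ‖w‖ ^ (l + 1) * g t at hR
    set S' := ∑ k ∈ Finset.Icc 1 (l + 1), deriv (sigma p m k) t * w ^ k
    -- The terms containing `Z - S Y` cancel against the derivative of the integrating factor,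
    -- leaving the residual times `Y`.
    have e : ∀ ex : ℂ, ex * (ζ + p t * S t) * (Z t - S t * Y t)
        + ex * (m t * Y t + -ζ * Z t - (S' * Y t + S t * (0 * Y t + p t * Z t)))
        = ex * ((m t - ζ * S t - S' - p t * S t ^ 2) * Y t) := fun ex => by ring
    have e2 := e (Complex.exp (ζ * t + Θ t))
    refine (le_of_eq (congrArg norm e2)).trans ?_
    rw [norm_mul, norm_mul]
    calc _ ≤ (Real.exp (ζ.re * t) * E) * ((‖w‖ ^ (l + 1) * g t) * A) :=
          mul_le_mul (hexp t ht) (mul_le_mul hR (hA t ht) (norm_nonneg _)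
            ((norm_nonneg _).trans hR)) (by positivity) (by positivity)
      _ = _ := by ring
  have hgx : IntervalIntegrable g volume 0 x := hgint.mono_set hxs
  have hFint := absolutelyContinuous_integral_deriv (hFac.mono hxs)
  have hbound := intervalIntegral.norm_integral_le_of_norm_le hx.1 hFd
    ((hgx.const_mul _).continuousOn_mul (Continuous.continuousOn (by fun_prop)))
  rw [hFint] at hbound
  have hF0 : ‖F 0‖ ≤ N * ‖w‖ := by
    simpa [hF, hΘ0, hY0, hZ0] using hSb 0 (by norm_num)
  have hFx : ‖F x‖ ≤ N * ‖w‖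
      + ∫ t in (0 : ℝ)..x, Real.exp (ζ.re * t) * (E * A * ‖w‖ ^ (l + 1) * g t) := by
    have := norm_add_le (F 0) (F x - F 0)
    rw [add_sub_cancel] at this
    linarith
  have hV : Z x - S x * Y x = Complex.exp (-(ζ * x + Θ x)) * F x := by
    simp only [hF]
    rw [← mul_assoc, ← Complex.exp_add, neg_add_cancel, Complex.exp_zero, one_mul]
  have hexp' : ‖Complex.exp (-(ζ * x + Θ x))‖ ≤ Real.exp (-(ζ.re * x)) * E := by
    rw [Complex.norm_exp, ← Real.exp_add, Real.exp_le_exp]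
    have := (Complex.abs_re_le_norm (Θ x)).trans (hΘb x hx)
    have := (abs_le.1 this).1
    simp only [Complex.neg_re, Complex.add_re, Complex.mul_re, Complex.ofReal_re,
      Complex.ofReal_im, mul_zero, sub_zero]
    linarith
  have hI : ∫ t in (0 : ℝ)..x, Real.exp (-(ζ.re * (x - t))) * g t =
      Real.exp (-(ζ.re * x)) * ∫ t in (0 : ℝ)..x, Real.exp (ζ.re * t) * g t := by
    rw [← intervalIntegral.integral_const_mul]
    congr 1
    ext t
    rw [← mul_assoc, ← Real.exp_add]
    congr 2
    ring
  have hI2 : ∫ t in (0 : ℝ)..x, Real.exp (ζ.re * t) * (E * A * ‖w‖ ^ (l + 1) * g t) =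
      (E * A * ‖w‖ ^ (l + 1)) * ∫ t in (0 : ℝ)..x, Real.exp (ζ.re * t) * g t := by
    rw [← intervalIntegral.integral_const_mul]
    congr 1
    ext t
    ring
  have hI0 : 0 ≤ ∫ t in (0 : ℝ)..x, Real.exp (ζ.re * t) * g t :=
    intervalIntegral.integral_nonneg hx.1 fun t _ => by positivity
  rw [hI2] at hFx
  rw [hV, norm_mul, hI]
  set J := ∫ t in (0 : ℝ)..x, Real.exp (ζ.re * t) * g t
  set e := Real.exp (-(ζ.re * x))
  have he : 0 ≤ e := (Real.exp_pos _).le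
  calc _ ≤ (e * E) * (N * ‖w‖ + (E * A * ‖w‖ ^ (l + 1)) * J) :=
        mul_le_mul hexp' hFx (norm_nonneg _) (by positivity)
    _ = (E * N) * e * ‖w‖ + (E * E) * A * ‖w‖ ^ (l + 1) * (e * J) := by ring
    _ ≤ (E * N + E * E) * e * ‖w‖ + (E * N + E * E) * A * ‖w‖ ^ (l + 1) * (e * J) := by
        gcongr
        · linarith [mul_nonneg hE0 hE0]
        · linarith [mul_nonneg hE0 hN0]

/-- Dominated convergence: the kernel is at most `1` and tends to `0` for `t < 1`. Since `g` is only
integrable, no rate is obtained, which is why the final remainder is `o` and not `O` of the next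
power. -/
lemma tendsto_integral_exp_mul {g : ℝ → ℝ} (hg : IntervalIntegrable g volume 0 1) :
    Tendsto (fun κ : ℝ => ∫ t in (0 : ℝ)..1, Real.exp (-(κ * (1 - t))) * g t) atTop (𝓝 0) := by
  have h : Tendsto (fun κ : ℝ => ∫ t in (0 : ℝ)..1, Real.exp (-(κ * (1 - t))) * g t) atTop
      (𝓝 (∫ _t in (0 : ℝ)..1, (0 : ℝ))) := by
    refine intervalIntegral.tendsto_integral_filter_of_dominated_convergence (fun t => ‖g t‖)
      ?_ ?_ hg.norm ?_
    · refine Eventually.of_forall fun κ => ?_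
      exact (Continuous.aestronglyMeasurable (by fun_prop)).mul
        hg.aestronglyMeasurable_restrict_uIoc
    · filter_upwards [eventually_ge_atTop 0] with κ hκ
      refine Eventually.of_forall fun t ht => ?_
      rw [uIoc_of_le zero_le_one] at ht
      rw [norm_mul, Real.norm_of_nonneg (Real.exp_pos _).le]
      refine mul_le_of_le_one_left (norm_nonneg _) (Real.exp_le_one_iff.2 ?_)
      have := mul_nonneg hκ (sub_nonneg.2 ht.2)
      linarith
    · have hne : ∀ᵐ t : ℝ, t ≠ 1 := by simp [ae_iff]
      filter_upwards [hne] with t ht ht'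
      rw [uIoc_of_le zero_le_one] at ht'
      have ht1 : 0 < 1 - t := sub_pos.2 (lt_of_le_of_ne ht'.2 ht)
      have h1 : Tendsto (fun κ : ℝ => Real.exp (-(κ * (1 - t)))) atTop (𝓝 0) :=
        Real.tendsto_exp_neg_atTop_nhds_zero.comp (tendsto_id.atTop_mul_const ht1)
      simpa using h1.mul_const (g t)
  simpa using h

/-- Asymptotics of the solution with initial value `(1, 0)` when the first component dominates. -/
theorem column_estimate {p m : ℝ → ℂ} {l : ℕ} (hp : ACDiff l p) (hm : ACDiff l m) :
    ∃ (C K : ℝ) (ε : ℝ → ℝ), Tendsto ε atTop (𝓝 0) ∧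
      ∀ ζ : ℂ, K ≤ ζ.re → ∀ Y Z : ℝ → ℂ, Solves 0 (-ζ) p m Y Z → Y 0 = 1 → Z 0 = 0 →
      ‖Y 1 - 1‖ ≤ C * ‖ζ‖⁻¹ ∧
      ‖Z 1 - formalSum p m (l + 1) ζ⁻¹ 1 * Y 1‖
        ≤ C * Real.exp (-ζ.re) + ε ζ.re * ‖ζ‖⁻¹ ^ (l + 1) := by
  obtain ⟨C, g, hC0, hg0, hgint, H⟩ := exists_deviation_bound hp hm
  obtain ⟨P, hP⟩ := isCompact_Icc.exists_bound_of_continuousOn hp.continuousOn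
  obtain ⟨M, hM0, hM⟩ := exists_sigma_bound hp hm
  have hP0 : 0 ≤ P := (norm_nonneg _).trans (hP 0 (by norm_num))
  set N : ℝ := (l + 1 : ℕ) * M with hNdef
  have hN0 : 0 ≤ N := by positivity
  set I := ∫ t in (0 : ℝ)..1, g t with hI
  have hI0 : 0 ≤ I := intervalIntegral.integral_nonneg zero_le_one fun t _ => hg0 t
  set d₀ := P * C with hd₀
  set d₁ := P * N + P * (C * I) with hd₁
  have hd₀0 : 0 ≤ d₀ := by positivity
  have hd₁0 : 0 ≤ d₁ := by positivity
  -- The threshold `1 + 2 * d₁` makes `d₁ / ‖ζ‖ ≤ 1/2`, and `2 * (1 + d₀)` is the resulting uniform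
  -- bound for `Y`.
  refine ⟨C + (d₀ + d₁ * (2 * (1 + d₀))), 1 + 2 * d₁,
    fun κ => C * (2 * (1 + d₀)) * ∫ t in (0 : ℝ)..1, Real.exp (-(κ * (1 - t))) * g t, ?_, ?_⟩
  · simpa using (tendsto_integral_exp_mul hgint).const_mul (C * (2 * (1 + d₀)))
  intro ζ hζ Y Z hS hY0 hZ0
  have hζn : 1 + 2 * d₁ ≤ ‖ζ‖ := hζ.trans (Complex.re_le_norm ζ)
  have hζ1 : 1 ≤ ‖ζ‖ := by linarith
  have hre : 0 ≤ ζ.re := by linarith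
  set r := ‖ζ⁻¹‖ with hr
  have hr' : ‖ζ‖⁻¹ = r := (norm_inv ζ).symm
  have hr0 : 0 ≤ r := norm_nonneg _
  have hr1 : r ≤ 1 := by rw [← hr']; exact inv_le_one_of_one_le₀ hζ1
  have hrd : r * d₁ ≤ 1 / 2 := by
    rw [← hr', inv_mul_le_iff₀ (by linarith)]
    linarith
  obtain ⟨x₀, hx₀, hmax⟩ := isCompact_Icc.exists_isMaxOn (nonempty_Icc.2 (zero_le_one' ℝ))
    hS.continuousOn_fst.norm
  set A := ‖Y x₀‖ with hAdef
  have hA : ∀ x ∈ Icc (0 : ℝ) 1, ‖Y x‖ ≤ A := fun x hx => hmax hx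
  have hA0 : 0 ≤ A := norm_nonneg _
  have hV := H ζ hζ1 Y Z hS hY0 hZ0 A hA
  have hV' : ∀ x ∈ Icc (0 : ℝ) 1,
      ‖Z x - formalSum p m (l + 1) ζ⁻¹ x * Y x‖ ≤ r * (C + C * I * A) := by
    intro x hx
    refine (hV x hx).trans ?_
    have h1 : Real.exp (-(ζ.re * x)) ≤ 1 :=
      Real.exp_le_one_iff.2 (by linarith [mul_nonneg hre hx.1])
    have hxs : uIcc 0 x ⊆ uIcc (0 : ℝ) 1 := by
      rw [uIcc_of_le hx.1, uIcc_of_le zero_le_one]; exact Icc_subset_Icc_right hx.2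
    have hgx : IntervalIntegrable g volume 0 x := hgint.mono_set hxs
    have h2 : ∫ t in (0 : ℝ)..x, Real.exp (-(ζ.re * (x - t))) * g t ≤ I := by
      calc _ ≤ ∫ t in (0 : ℝ)..x, g t := by
            refine intervalIntegral.integral_mono_on hx.1
              (hgx.continuousOn_mul (Continuous.continuousOn (by fun_prop))) hgx fun t ht => ?_
            refine mul_le_of_le_one_left (hg0 t) (Real.exp_le_one_iff.2 ?_)
            linarith [mul_nonneg hre (sub_nonneg.2 ht.2)]
        _ ≤ I := intervalIntegral.integral_mono_interval le_rfl hx.1 hx.2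
            (Eventually.of_forall hg0) hgint
    have h3 : r ^ (l + 1) ≤ r := pow_le_of_le_one hr0 hr1 (by omega)
    have h4 : 0 ≤ ∫ t in (0 : ℝ)..x, Real.exp (-(ζ.re * (x - t))) * g t :=
      intervalIntegral.integral_nonneg hx.1 fun t _ => mul_nonneg (Real.exp_pos _).le (hg0 t)
    calc _ ≤ C * 1 * r + C * A * r * I := by gcongr
      _ = _ := by ring
  have hYd : ∀ x ∈ Icc (0 : ℝ) 1, ‖0 * Y x + p x * Z x‖ ≤ r * (d₀ + d₁ * A) := by
    intro x hx
    have e : 0 * Y x + p x * Z x = p x * (Z x - formalSum p m (l + 1) ζ⁻¹ x * Y x)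
        + p x * (formalSum p m (l + 1) ζ⁻¹ x * Y x) := by ring
    have hs : ‖formalSum p m (l + 1) ζ⁻¹ x‖ ≤ N * r :=
      norm_sum_mul_pow_le (fun k hk => hM k hk x hx) hr1
    rw [e]
    refine (norm_add_le _ _).trans ?_
    rw [norm_mul, norm_mul, norm_mul (formalSum _ _ _ _ _)]
    calc _ ≤ P * (r * (C + C * I * A)) + P * (N * r * A) := by
          gcongr
          · exact hP x hx
          · exact hV' x hx
          · exact hP x hx
          · exact hA x hx
      _ = _ := by rw [hd₀, hd₁]; ring
  have hdev : ∀ x ∈ Icc (0 : ℝ) 1, ‖Y x - 1‖ ≤ r * (d₀ + d₁ * A) := by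
    intro x hx
    have h1 := (convex_Icc (0 : ℝ) 1).norm_image_sub_le_of_norm_hasDerivWithin_le
      (fun t ht => (hS t ht).1) hYd (left_mem_Icc.2 zero_le_one) hx
    rw [hY0, sub_zero, Real.norm_eq_abs, abs_of_nonneg hx.1] at h1
    exact h1.trans (mul_le_of_le_one_right (by positivity) hx.2)
  -- At the maximum point of `‖Y‖` one has `A ≤ 1 + d₀ + A / 2`, and the last term is absorbed on
  -- the left.
  have hA2 : A ≤ 2 * (1 + d₀) := by
    have h1 := hdev x₀ hx₀
    have h2 : A ≤ ‖Y x₀ - 1‖ + 1 := by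
      have := norm_add_le (Y x₀ - 1) 1
      rwa [sub_add_cancel, norm_one] at this
    have h3 : r * (d₀ + d₁ * A) ≤ d₀ + 1 / 2 * A := by
      have := mul_le_mul_of_nonneg_right hrd hA0
      have := mul_le_of_le_one_left hd₀0 hr1
      linarith
    linarith
  rw [hr']
  constructor
  · refine (hdev 1 (right_mem_Icc.2 zero_le_one)).trans ?_
    rw [mul_comm]
    refine mul_le_mul_of_nonneg_right ?_ hr0
    have := mul_le_mul_of_nonneg_left hA2 hd₁0
    linarith
  · refine (hV 1 (right_mem_Icc.2 zero_le_one)).trans ?_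
    have hJ0 : 0 ≤ ∫ t in (0 : ℝ)..1, Real.exp (-(ζ.re * (1 - t))) * g t :=
      intervalIntegral.integral_nonneg zero_le_one fun t _ => mul_nonneg (Real.exp_pos _).le (hg0 t)
    set J := ∫ t in (0 : ℝ)..1, Real.exp (-(ζ.re * (1 - t))) * g t
    rw [mul_one]
    have hex := (Real.exp_pos (-ζ.re)).le
    have h1 : C * Real.exp (-ζ.re) * r ≤ (C + (d₀ + d₁ * (2 * (1 + d₀)))) * Real.exp (-ζ.re) := by
      refine (mul_le_of_le_one_right (by positivity) hr1).trans ?_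
      gcongr
      have : 0 ≤ d₀ + d₁ * (2 * (1 + d₀)) := by positivity
      linarith
    have h2 : C * A * r ^ (l + 1) * J ≤ C * (2 * (1 + d₀)) * J * r ^ (l + 1) := by
      rw [mul_right_comm _ J]
      gcongr
    linarith

/-! ### Reflection of the interval -/

lemma reflect_mem_unitInterval {x : ℝ} (hx : x ∈ Icc (0 : ℝ) 1) : 1 - x ∈ Icc (0 : ℝ) 1 :=
  ⟨by linarith [hx.2], by linarith [hx.1]⟩

lemma reflect_hasDerivWithinAt {f : ℝ → ℂ} {f' : ℂ} {x : ℝ}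
    (h : HasDerivWithinAt f f' (Icc 0 1) (1 - x)) :
    HasDerivWithinAt (fun t => f (1 - t)) (-f') (Icc 0 1) x := by
  have h1 : HasDerivWithinAt (fun t : ℝ => 1 - t) (-1) (Icc 0 1) x :=
    (hasDerivWithinAt_id x _).const_sub 1
  refine (HasDerivWithinAt.scomp x h h1 fun t ht => reflect_mem_unitInterval ht).congr_deriv ?_
  simp

lemma absolutelyContinuous_reflect {f : ℝ → ℂ} (hf : AbsolutelyContinuousOnInterval f 0 1) :
    AbsolutelyContinuousOnInterval (fun x => f (1 - x)) 0 1 := by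
  rw [absolutelyContinuousOnInterval_iff] at hf ⊢
  intro ε hε
  obtain ⟨δ, hδ, H⟩ := hf ε hε
  refine ⟨δ, hδ, fun E hE hlt => ?_⟩
  refine H (E.1, fun i => (1 - (E.2 i).1, 1 - (E.2 i).2)) ⟨fun i hi => ?_, ?_⟩ ?_
  · have h := hE.1 i hi
    rw [uIcc_of_le zero_le_one] at h ⊢
    exact ⟨reflect_mem_unitInterval h.1, reflect_mem_unitInterval h.2⟩
  · intro i hi j hj hij
    have h := hE.2 hi hj hij
    simp only [Function.onFun, uIoc, Ioc_disjoint_Ioc] at h ⊢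
    simp only [max_sub_sub_left, min_sub_sub_left] at h ⊢
    linarith
  · simpa only [dist_sub_left] using hlt

lemma reflect_derivWithin (f : ℝ → ℂ) (x : ℝ) :
    derivWithin (fun t => f (1 - t)) (Icc 0 1) x = -derivWithin f (Icc 0 1) (1 - x) := by
  rw [derivWithin_comp_const_sub]
  congr 2
  ext t
  simp only [mem_vadd_set, Set.mem_neg, mem_Icc, vadd_eq_add]
  constructor
  · rintro ⟨s, hs, rfl⟩
    constructor <;> linarith [hs.1, hs.2]
  · intro ht
    exact ⟨t - 1, ⟨by linarith [ht.2], by linarith [ht.1]⟩, by ring⟩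

lemma ACDiff.reflect {k : ℕ} {f : ℝ → ℂ} (h : ACDiff k f) : ACDiff k (fun x => f (1 - x)) := by
  induction k generalizing f with
  | zero => exact absolutelyContinuous_reflect h
  | succ k ih =>
    refine ⟨fun x hx => ?_, (ih h.2).neg.congr fun x _ => (reflect_derivWithin f x).symm⟩
    exact (reflect_hasDerivWithinAt
      (h.1 _ (reflect_mem_unitInterval hx)).hasDerivWithinAt).differentiableWithinAt

/-- Reflection changes the sign of the derivative, while a product of terms with indices `j` and `k
- j` acquires `(-1)^(k - 2) = (-1)^k`. Both parts of the recursion therefore gain the same sign. -/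
lemma sigma_reflect (p m : ℝ → ℂ) : ∀ k, 1 ≤ k → ∀ x : ℝ,
    sigma (fun t => p (1 - t)) (fun t => m (1 - t)) k x = (-1) ^ (k - 1) * sigma p m k (1 - x) := by
  intro k
  induction k using Nat.strong_induction_on with
  | _ k ih =>
    intro h1 x
    rcases Nat.lt_or_ge 1 k with hk | hk
    · obtain ⟨k, rfl⟩ : ∃ i, k = i + 2 := ⟨k - 2, by omega⟩
      have e : sigma (fun t => p (1 - t)) (fun t => m (1 - t)) (k + 1) =
          fun t => (fun s => (-1) ^ k * sigma p m (k + 1) s) (1 - t) := by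
        ext t
        exact ih (k + 1) (by omega) (by omega) t
      have e2 : ∑ j ∈ Finset.Icc 1 k, sigma (fun t => p (1 - t)) (fun t => m (1 - t)) j x *
          sigma (fun t => p (1 - t)) (fun t => m (1 - t)) (k + 1 - j) x =
          (-1) ^ (k + 1) * ∑ j ∈ Finset.Icc 1 k,
            sigma p m j (1 - x) * sigma p m (k + 1 - j) (1 - x) := by
        rw [Finset.mul_sum]
        refine Finset.sum_congr rfl fun j hj => ?_
        rw [Finset.mem_Icc] at hj
        rw [ih j (by omega) hj.1, ih (k + 1 - j) (by omega) (by omega)]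
        have : (-1 : ℂ) ^ (k + 1) = (-1) ^ (j - 1) * (-1) ^ (k + 1 - j - 1) := by
          obtain ⟨i, rfl⟩ : ∃ i, j = i + 1 := ⟨j - 1, by omega⟩
          obtain ⟨d, rfl⟩ : ∃ d, k = i + 1 + d := ⟨k - (i + 1), by omega⟩
          rw [← pow_add, show i + 1 - 1 + (i + 1 + d + 1 - (i + 1) - 1) = i + d by omega]
          ring
        rw [this]
        ring
      rw [sigma_succ _ _ (by omega), sigma_succ _ _ (by omega), e,
        reflect_derivWithin (fun s => (-1) ^ k * sigma p m (k + 1) s), Nat.add_sub_cancel, e2,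
        derivWithin_const_mul_field]
      have : k + 1 + 1 - 1 = k + 1 := rfl
      rw [this]
      ring
    · obtain rfl : k = 1 := by omega
      simp [sigma_one]

/-! ### Transformations of first order systems -/

lemma hasDerivWithinAt_cexp_mul (c : ℂ) (x : ℝ) (s : Set ℝ) :
    HasDerivWithinAt (fun t : ℝ => Complex.exp (c * t)) (Complex.exp (c * x) * c) s x := by
  have h1 : HasDerivWithinAt (fun t : ℝ => c * (t : ℂ)) (c * 1) s x :=
    (Complex.ofRealCLM.hasDerivAt.const_mul c).hasDerivWithinAt
  rw [mul_one] at h1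
  exact h1.cexp

namespace Solves

variable {μ₁ μ₂ : ℂ} {p m : ℝ → ℂ}

lemma gauge {y₁ y₂ : ℝ → ℂ} (h : Solves μ₁ μ₂ p m y₁ y₂) (ν : ℂ) :
    Solves (μ₁ + ν) (μ₂ + ν) p m (fun x => Complex.exp (ν * x) * y₁ x)
      (fun x => Complex.exp (ν * x) * y₂ x) := by
  intro x hx
  constructor
  · refine ((hasDerivWithinAt_cexp_mul ν x _).mul (h x hx).1).congr_deriv ?_
    ring
  · refine ((hasDerivWithinAt_cexp_mul ν x _).mul (h x hx).2).congr_deriv ?_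
    ring

lemma linearCombination {y₁ y₂ w₁ w₂ : ℝ → ℂ} (h : Solves μ₁ μ₂ p m y₁ y₂)
    (h' : Solves μ₁ μ₂ p m w₁ w₂) (a b : ℂ) :
    Solves μ₁ μ₂ p m (fun x => a * y₁ x + b * w₁ x) (fun x => a * y₂ x + b * w₂ x) := by
  intro x hx
  constructor
  · refine (((h x hx).1.const_mul a).add ((h' x hx).1.const_mul b)).congr_deriv ?_
    ring
  · refine (((h x hx).2.const_mul a).add ((h' x hx).2.const_mul b)).congr_deriv ?_
    ring

/-- The adjoint solution, read from right to left, solves a system of the same kind. -/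
lemma reflect_adjoint {y₁ y₂ : ℝ → ℂ} (h : Solves μ₁ μ₂ p m y₁ y₂) :
    Solves μ₁ μ₂ (fun x => m (1 - x)) (fun x => p (1 - x))
      (fun x => Complex.exp (-(μ₁ + μ₂) * (1 - x : ℝ)) * y₂ (1 - x))
      (fun x => -(Complex.exp (-(μ₁ + μ₂) * (1 - x : ℝ)) * y₁ (1 - x))) := by
  intro x hx
  have hg := h.gauge (-(μ₁ + μ₂)) (1 - x) (reflect_mem_unitInterval hx)
  constructor
  · refine (reflect_hasDerivWithinAt hg.2).congr_deriv ?_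
    ring
  · refine (reflect_hasDerivWithinAt hg.1).neg.congr_deriv ?_
    ring

/-- Liouville's formula: the trace of the coefficient matrix is the constant `μ₁ + μ₂`. -/
lemma wronskian {y₁ y₂ w₁ w₂ : ℝ → ℂ} (h : Solves μ₁ μ₂ p m y₁ y₂)
    (h' : Solves μ₁ μ₂ p m w₁ w₂) : ∀ x ∈ Icc (0 : ℝ) 1,
    y₁ x * w₂ x - w₁ x * y₂ x =
      Complex.exp ((μ₁ + μ₂) * x) * (y₁ 0 * w₂ 0 - w₁ 0 * y₂ 0) := by
  have hd : ∀ x ∈ Icc (0 : ℝ) 1, HasDerivWithinAt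
      (fun t : ℝ => Complex.exp (-(μ₁ + μ₂) * t) * (y₁ t * w₂ t - w₁ t * y₂ t)) 0 (Icc 0 1) x := by
    intro x hx
    refine ((hasDerivWithinAt_cexp_mul (-(μ₁ + μ₂)) x _).mul
      (((h x hx).1.mul (h' x hx).2).sub ((h' x hx).1.mul (h x hx).2))).congr_deriv ?_
    simp only [Pi.mul_apply, Pi.sub_apply]
    ring
  intro x hx
  have hc := constant_of_derivWithin_zero (fun t ht => (hd t ht).differentiableWithinAt)
    (fun t ht => (hd t (Ico_subset_Icc_self ht)).derivWithin
      (uniqueDiffWithinAt_unitInterval (Ico_subset_Icc_self ht))) x hx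
  simp only [Complex.ofReal_zero, mul_zero, Complex.exp_zero, one_mul] at hc
  rw [← hc, ← mul_assoc, ← Complex.exp_add, neg_mul, add_neg_cancel,
    Complex.exp_zero, one_mul]

end Solves

/-! ### The characteristic determinant in terms of the fundamental matrix -/

lemma charDet_eq (a : Matrix (Fin 2) (Fin 4) ℂ) (Φ : ℂ → ℝ → Matrix (Fin 2) (Fin 2) ℂ) (z : ℂ)
    (h : Φ z 0 = 1) :
    charDet a Φ z = minorJ a 0 1 + minorJ a 2 3 * (Φ z 1 0 0 * Φ z 1 1 1 - Φ z 1 0 1 * Φ z 1 1 0)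
      + J32 a * Φ z 1 0 0 + J13 a * Φ z 1 0 1 + J42 a * Φ z 1 1 0 + J14 a * Φ z 1 1 1 := by
  simp only [charDet, J32, J13, J42, J14, minorJ, boundaryForm, h, Matrix.det_fin_two,
    Matrix.of_apply, Matrix.submatrix_apply, id_eq, Matrix.cons_val_zero, Matrix.cons_val_one,
    Matrix.one_apply_eq, ne_eq, one_ne_zero, zero_ne_one, not_false_eq_true, Matrix.one_apply_ne]
  ring

/-- This makes the column estimate applicable to a row. The combination of adjoint solutions with
weights `y₁ 1` and `-w₁ 1` starts at `(1, 0)` because its first component there is the normalized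
Wronskian, and it ends at the first row of the fundamental matrix. -/
lemma Solves.exists_first_row {μ₁ μ₂ : ℂ} {p m y₁ y₂ w₁ w₂ : ℝ → ℂ} (h : Solves μ₁ μ₂ p m y₁ y₂)
    (h' : Solves μ₁ μ₂ p m w₁ w₂) (hy₁ : y₁ 0 = 1) (hy₂ : y₂ 0 = 0) (hw₁ : w₁ 0 = 0)
    (hw₂ : w₂ 0 = 1) :
    ∃ X₁ X₂, Solves μ₁ μ₂ (fun x => m (1 - x)) (fun x => p (1 - x)) X₁ X₂ ∧ X₁ 0 = 1 ∧ X₂ 0 = 0 ∧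
      X₁ 1 = y₁ 1 ∧ X₂ 1 = w₁ 1 := by
  have hW := h.wronskian h' 1 (right_mem_Icc.2 zero_le_one)
  refine ⟨_, _, h'.reflect_adjoint.linearCombination h.reflect_adjoint (y₁ 1) (-w₁ 1),
    ?_, ?_, ?_, ?_⟩
  · have he : Complex.exp (-(μ₁ + μ₂) * (1 - 0 : ℝ)) * Complex.exp ((μ₁ + μ₂) * (1 : ℝ)) = 1 := by
      rw [← Complex.exp_add]; simp
    rw [hy₁, hy₂, hw₁, hw₂] at hW
    simp only [sub_zero] at he ⊢
    linear_combination Complex.exp (-(μ₁ + μ₂) * (1 : ℝ)) * hW + he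
  · simp only [sub_zero]
    ring
  · simp [hy₂, hw₂]
  · simp [hy₁, hw₁]

/-! ### The limit in the upper half-plane -/

lemma tendsto_im_upperFilter (n : ℕ) (β : ℝ) : Tendsto Complex.im (upperFilter n β) atTop :=
  tendsto_comap.mono_left inf_le_left

lemma tendsto_norm_upperFilter (n : ℕ) (β : ℝ) :
    Tendsto (fun z : ℂ => ‖z‖) (upperFilter n β) atTop :=
  tendsto_atTop_mono (fun z => (le_abs_self _).trans (Complex.abs_im_le_norm z))
    (tendsto_im_upperFilter n β)

/-- The growth restriction built into the filter says precisely that `exp(-β |Im z|)` is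
`o(|z|^{-n})`. -/
lemma isLittleO_inv_pow_of_norm_le {n : ℕ} {β C : ℝ} {ρ : ℂ → ℂ} {δ : ℂ → ℝ}
    (hδ : Tendsto δ (upperFilter n β) (𝓝 0))
    (h : ∀ᶠ z in upperFilter n β,
      ‖ρ z‖ ≤ C * Real.exp (-β * |z.im|) + δ z * ‖z‖⁻¹ ^ n) :
    ρ =o[upperFilter n β] (fun z : ℂ => (z ^ n)⁻¹) := by
  have hne : ∀ᶠ z : ℂ in upperFilter n β, ‖z‖ ≠ 0 :=
    ((tendsto_norm_upperFilter n β).eventually_gt_atTop 0).mono fun z hz => hz.ne'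
  have h1 : (fun z : ℂ => Real.exp (-β * |z.im|)) =o[upperFilter n β]
      (fun z : ℂ => ‖z‖⁻¹ ^ n) := by
    refine isLittleO_of_tendsto' ?_ ?_
    · filter_upwards [hne] with z hz h0
      exact absurd h0 (pow_ne_zero _ (inv_ne_zero hz))
    · have : Tendsto (fun z : ℂ => ‖z‖ ^ n * Real.exp (-β * |z.im|)) (upperFilter n β) (𝓝 0) :=
        tendsto_comap.mono_left inf_le_right
      refine this.congr fun z => ?_
      rw [inv_pow, div_inv_eq_mul, mul_comm]
  have h2 : (fun z : ℂ => δ z * ‖z‖⁻¹ ^ n) =o[upperFilter n β] (fun z : ℂ => ‖z‖⁻¹ ^ n) := by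
    simpa using ((isLittleO_one_iff ℝ).2 hδ).mul_isBigO (isBigO_refl (fun z : ℂ => ‖z‖⁻¹ ^ n) _)
  have h3 := (h1.const_mul_left C).add h2
  have h4 : ρ =O[upperFilter n β]
      fun z => C * Real.exp (-β * |z.im|) + δ z * ‖z‖⁻¹ ^ n := by
    refine IsBigO.of_bound 1 ?_
    filter_upwards [h] with z hz
    rw [one_mul]
    exact hz.trans (le_abs_self _)
  have h5 := h4.trans_isLittleO h3
  rw [← isLittleO_norm_right]
  simpa only [norm_inv, norm_pow, inv_pow] using h5

lemma cConst_mul_re (b₁ b₂ : ℝ) (z : ℂ) : (cConst b₁ b₂ * z).re = (b₂ - b₁) * z.im := by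
  simp [cConst]
  ring

lemma cConst_mul_norm {b₁ b₂ : ℝ} (h : b₁ < b₂) (z : ℂ) :
    ‖cConst b₁ b₂ * z‖ = (b₂ - b₁) * ‖z‖ := by
  rw [cConst, norm_mul, norm_mul, Complex.norm_I, one_mul, ← Complex.ofReal_sub, Complex.norm_real,
    Real.norm_eq_abs, abs_of_neg (by linarith)]
  ring

lemma column_asymptotics {b₁ b₂ : ℝ} (hb₁ : b₁ < 0) (hb₂ : 0 < b₂) {p m : ℝ → ℂ} {l : ℕ}
    (hp : ACDiff l p) (hm : ACDiff l m) {y₁ y₂ : ℂ → ℝ → ℂ}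
    (hS : ∀ z, Solves (Complex.I * b₁ * z) (Complex.I * b₂ * z) p m (y₁ z) (y₂ z))
    (h₁ : ∀ z, y₁ z 0 = 1) (h₂ : ∀ z, y₂ z 0 = 0) :
    Tendsto (fun z => Complex.exp (-(Complex.I * b₁ * z)) * y₁ z 1)
      (upperFilter (l + 1) (min |b₁| b₂)) (𝓝 1) ∧
    (fun z => Complex.exp (-(Complex.I * b₁ * z)) * y₂ z 1 -
        formalSum p m (l + 1) (cConst b₁ b₂ * z)⁻¹ 1 *
          (Complex.exp (-(Complex.I * b₁ * z)) * y₁ z 1))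
      =o[upperFilter (l + 1) (min |b₁| b₂)] (fun z : ℂ => (z ^ (l + 1))⁻¹) := by
  obtain ⟨C, K, ε, hε, H⟩ := column_estimate hp hm
  set β := min |b₁| b₂ with hβ
  have hd : 0 < b₂ - b₁ := by linarith
  have him := tendsto_im_upperFilter (l + 1) β
  have hre : Tendsto (fun z => (cConst b₁ b₂ * z).re) (upperFilter (l + 1) β) atTop := by
    simp_rw [cConst_mul_re]
    exact him.const_mul_atTop hd
  have hnorm : Tendsto (fun z => ‖cConst b₁ b₂ * z‖) (upperFilter (l + 1) β) atTop :=
    tendsto_atTop_mono (fun z => Complex.re_le_norm _) hre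
  have key : ∀ᶠ z in upperFilter (l + 1) β,
      ‖Complex.exp (-(Complex.I * b₁ * z)) * y₁ z 1 - 1‖ ≤ C * ‖cConst b₁ b₂ * z‖⁻¹ ∧
      ‖Complex.exp (-(Complex.I * b₁ * z)) * y₂ z 1 -
        formalSum p m (l + 1) (cConst b₁ b₂ * z)⁻¹ 1 *
          (Complex.exp (-(Complex.I * b₁ * z)) * y₁ z 1)‖ ≤
        C * Real.exp (-(cConst b₁ b₂ * z).re) +
          ε (cConst b₁ b₂ * z).re * ‖cConst b₁ b₂ * z‖⁻¹ ^ (l + 1) := by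
    filter_upwards [hre.eventually_ge_atTop K] with z hz
    have hg := (hS z).gauge (-(Complex.I * b₁ * z))
    rw [add_neg_cancel, show Complex.I * b₂ * z + -(Complex.I * b₁ * z) = -(cConst b₁ b₂ * z) by
      rw [cConst]; ring] at hg
    have := H _ hz _ _ hg (by simp [h₁]) (by simp [h₂])
    simpa only [Complex.ofReal_one, mul_one] using this
  constructor
  · rw [tendsto_iff_norm_sub_tendsto_zero]
    refine squeeze_zero' (Eventually.of_forall fun z => norm_nonneg _) (key.mono fun z h => h.1) ?_
    simpa using (tendsto_inv_atTop_zero.comp hnorm).const_mul C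
  · have hδ : Tendsto (fun z => ε (cConst b₁ b₂ * z).re * ((b₂ - b₁)⁻¹) ^ (l + 1))
        (upperFilter (l + 1) β) (𝓝 0) := by
      simpa using (hε.comp hre).mul_const (((b₂ - b₁)⁻¹) ^ (l + 1))
    refine isLittleO_inv_pow_of_norm_le (C := |C|) hδ ?_
    filter_upwards [key, him.eventually_ge_atTop 0] with z hz hz0
    refine hz.2.trans (add_le_add ?_ (le_of_eq ?_))
    · refine mul_le_mul (le_abs_self C) (Real.exp_le_exp.2 ?_) (Real.exp_pos _).le (abs_nonneg C)
      rw [cConst_mul_re, abs_of_nonneg hz0]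
      -- Hence `exp(-Re ζ) ≤ exp(-β Im z)`, so the contribution of the initial value is absorbed by
      -- the filter.
      have : β ≤ b₂ - b₁ := (min_le_right _ _).trans (by linarith)
      have := mul_le_mul_of_nonneg_right this hz0
      linarith
    · rw [cConst_mul_norm (by linarith), mul_inv, mul_pow]
      ring

lemma formalSum_isBigO_one (p m : ℝ → ℂ) (n : ℕ) (x : ℝ) {b₁ b₂ : ℝ} (h : b₁ < b₂) (β : ℝ)
    (k : ℕ) :
    (fun z => formalSum p m n (cConst b₁ b₂ * z)⁻¹ x) =O[upperFilter k β] (fun _ => (1 : ℂ)) := by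
  have h0 : Tendsto (fun z => ‖(cConst b₁ b₂ * z)⁻¹‖) (upperFilter k β) (𝓝 0) := by
    simp_rw [norm_inv, cConst_mul_norm h]
    exact tendsto_inv_atTop_zero.comp
      ((tendsto_norm_upperFilter k β).const_mul_atTop (sub_pos.2 h))
  have hw := tendsto_zero_iff_norm_tendsto_zero.2 h0
  exact (tendsto_finsetSum (Finset.Icc 1 n) fun j _ =>
    (hw.pow j).const_mul (sigma p m j x)).isBigO_one ℂ

lemma isLittleO_truncated_product {b₁ b₂ : ℝ} (h : b₁ < b₂) (t s : ℕ → ℂ) (n : ℕ) (β : ℝ) :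
    (fun z => (∑ k ∈ Finset.Icc 1 n, t k * (cConst b₁ b₂ * z)⁻¹ ^ k)
        * (∑ k ∈ Finset.Icc 1 n, s k * (cConst b₁ b₂ * z)⁻¹ ^ k)
        - ∑ k ∈ Finset.Icc 1 n,
          (∑ j ∈ Finset.Icc 1 (k - 1), t j * s (k - j)) * (cConst b₁ b₂ * z)⁻¹ ^ k)
      =o[upperFilter n β] (fun z : ℂ => (z ^ n)⁻¹) := by
  set M := ∑ k ∈ Finset.Icc 1 n, (‖t k‖ + ‖s k‖) with hM
  have hle : ∀ k ∈ Finset.Icc 1 n, ‖t k‖ + ‖s k‖ ≤ M := fun k hk =>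
    Finset.single_le_sum (f := fun k => ‖t k‖ + ‖s k‖) (fun i _ => by positivity) hk
  have hnorm := tendsto_norm_upperFilter n β
  have hd : 0 < b₂ - b₁ := sub_pos.2 h
  have hδ : Tendsto (fun z : ℂ => (M ^ 2 * n ^ 2 * ((b₂ - b₁)⁻¹) ^ (n + 1)) * ‖z‖⁻¹)
      (upperFilter n β) (𝓝 0) := by
    simpa using (tendsto_inv_atTop_zero.comp hnorm).const_mul
      (M ^ 2 * n ^ 2 * ((b₂ - b₁)⁻¹) ^ (n + 1))
  refine isLittleO_inv_pow_of_norm_le (C := 0) hδ ?_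
  filter_upwards [(hnorm.const_mul_atTop hd).eventually_ge_atTop 1] with z hz
  have hw : ‖(cConst b₁ b₂ * z)⁻¹‖ ≤ 1 := by
    rw [norm_inv, cConst_mul_norm h]
    exact inv_le_one_of_one_le₀ hz
  refine (norm_sum_mul_sum_sub_trunc_le le_rfl (M := M)
    (fun k hk => by linarith [hle k hk, norm_nonneg (s k)])
    (fun k hk => by linarith [hle k hk, norm_nonneg (t k)]) hw).trans (le_of_eq ?_)
  rw [norm_inv, cConst_mul_norm h, mul_inv, mul_pow]
  ring

lemma isLittleO_cexp_of_le {n : ℕ} {β : ℝ} {μ : ℂ → ℂ}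
    (h : ∀ z : ℂ, 0 ≤ z.im → (μ z).re ≤ -β * z.im) :
    (fun z => Complex.exp (μ z)) =o[upperFilter n β] (fun z : ℂ => (z ^ n)⁻¹) := by
  refine isLittleO_inv_pow_of_norm_le (C := 1) (δ := fun _ => 0) tendsto_const_nhds ?_
  filter_upwards [(tendsto_im_upperFilter n β).eventually_ge_atTop 0] with z hz
  rw [one_mul, zero_mul, add_zero, Complex.norm_exp, abs_of_nonneg hz]
  exact Real.exp_le_exp.2 (h z hz)

/-- The formal expansion of `Δ_Q` divided by the dominating entry of the fundamental matrix. -/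
lemma formal_expansion (b₁ b₂ : ℝ) (Q₁₂ Q₂₁ : ℝ → ℂ) (a : Matrix (Fin 2) (Fin 4) ℂ) (n : ℕ)
    (w : ℂ) :
    ∑ k ∈ Finset.Icc 1 n, cPlus b₁ b₂ Q₁₂ Q₂₁ a k * w ^ k =
      J13 a * (∑ k ∈ Finset.Icc 1 n, (-1) ^ (k - 1) * sigmaMinus b₁ b₂ Q₁₂ Q₂₁ k 0 * w ^ k)
      + J42 a * (∑ k ∈ Finset.Icc 1 n, sigmaPlus b₁ b₂ Q₁₂ Q₂₁ k 1 * w ^ k)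
      + J14 a * ∑ k ∈ Finset.Icc 1 n, (∑ j ∈ Finset.Icc 1 (k - 1),
          ((-1) ^ (j - 1) * sigmaMinus b₁ b₂ Q₁₂ Q₂₁ j 0)
            * sigmaPlus b₁ b₂ Q₁₂ Q₂₁ (k - j) 1) * w ^ k := by
  rw [Finset.mul_sum, Finset.mul_sum, Finset.mul_sum, ← Finset.sum_add_distrib,
    ← Finset.sum_add_distrib]
  refine Finset.sum_congr rfl fun k _ => ?_
  have e : ∑ j ∈ Finset.Icc 1 (k - 1), (-1) ^ j * sigmaMinus b₁ b₂ Q₁₂ Q₂₁ j 0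
      * sigmaPlus b₁ b₂ Q₁₂ Q₂₁ (k - j) 1 = -∑ j ∈ Finset.Icc 1 (k - 1),
        ((-1) ^ (j - 1) * sigmaMinus b₁ b₂ Q₁₂ Q₂₁ j 0)
          * sigmaPlus b₁ b₂ Q₁₂ Q₂₁ (k - j) 1 := by
    rw [← Finset.sum_neg_distrib]
    refine Finset.sum_congr rfl fun j hj => ?_
    obtain ⟨i, rfl⟩ : ∃ i, j = i + 1 := ⟨j - 1, by rw [Finset.mem_Icc] at hj; omega⟩
    rw [Nat.add_sub_cancel, pow_succ]
    ring
  rw [cPlus, e]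
  ring

theorem charDet_upper_asymptotics {b₁ b₂ : ℝ} (hb₁ : b₁ < 0) (hb₂ : 0 < b₂) {l : ℕ}
    {Q₁₂ Q₂₁ : ℝ → ℂ} (hp : ACDiff l (qPlus b₁ Q₁₂)) (hm : ACDiff l (qMinus b₂ Q₂₁))
    (a : Matrix (Fin 2) (Fin 4) ℂ) {Φ : ℂ → ℝ → Matrix (Fin 2) (Fin 2) ℂ}
    (hΦ : IsFundamentalMatrix b₁ b₂ Q₁₂ Q₂₁ Φ) :
    ∃ r s : ℂ → ℂ,
      r =o[upperFilter (l + 1) (min |b₁| b₂)] (fun z : ℂ => (z ^ (l + 1))⁻¹) ∧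
      s =o[upperFilter (l + 1) (min |b₁| b₂)] (fun _ : ℂ => (1 : ℂ)) ∧
      ∀ᶠ z in upperFilter (l + 1) (min |b₁| b₂),
        charDet a Φ z = Complex.exp (Complex.I * b₁ * z) *
          (J32 a + ∑ k ∈ Finset.Icc 1 (l + 1),
              cPlus b₁ b₂ Q₁₂ Q₂₁ a k / (cConst b₁ b₂ * z) ^ k + r z) * (1 + s z) := by
  have hlt : b₁ < b₂ := hb₁.trans hb₂
  set F := upperFilter (l + 1) (min |b₁| b₂) with hF
  have hsol := fun z k => (isSolution_iff hb₁.ne hb₂.ne' hp.continuousOn hm.continuousOn z _).1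
    ((hΦ z).2 k)
  have h0 : ∀ z i k, Φ z 0 i k = (1 : Matrix (Fin 2) (Fin 2) ℂ) i k := fun z i k => by
    rw [(hΦ z).1]
  choose X₁ X₂ hX hX₁ hX₂ hX₃ hX₄ using fun z => (hsol z 0).exists_first_row (hsol z 1)
    (h0 z 0 0) (h0 z 1 0) (h0 z 0 1) (h0 z 1 1)
  obtain ⟨hα, hρ₁⟩ := column_asymptotics hb₁ hb₂ hp hm (fun z => hsol z 0)
    (fun z => h0 z 0 0) (fun z => h0 z 1 0)
  -- The reflected solution has the same dominating entry `Φ₁₁`, so only its remainder estimate is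
  -- new.
  obtain ⟨-, hρ₂⟩ := column_asymptotics hb₁ hb₂ hm.reflect hp.reflect hX hX₁ hX₂
  simp only [hX₃, hX₄] at hρ₂
  rw [← hF] at hα hρ₁ hρ₂
  set e : ℂ → ℂ := fun z => Complex.exp (-(Complex.I * b₁ * z)) with he
  set α : ℂ → ℂ := fun z => e z * Φ z 1 0 0 with hαdef
  set S : ℂ → ℂ := fun z => formalSum (qPlus b₁ Q₁₂) (qMinus b₂ Q₂₁) (l + 1)
    (cConst b₁ b₂ * z)⁻¹ 1 with hSdef
  set T : ℂ → ℂ := fun z => formalSum (fun x => qMinus b₂ Q₂₁ (1 - x))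
    (fun x => qPlus b₁ Q₁₂ (1 - x)) (l + 1) (cConst b₁ b₂ * z)⁻¹ 1 with hTdef
  set ρ₁ : ℂ → ℂ := fun z => e z * Φ z 1 1 0 - S z * α z
  set ρ₂ : ℂ → ℂ := fun z => e z * Φ z 1 0 1 - T z * α z
  set d : ℂ → ℂ := fun z => Complex.exp (Complex.I * b₁ * z + Complex.I * b₂ * z) with hd
  have hdet : ∀ z, Φ z 1 0 0 * Φ z 1 1 1 - Φ z 1 0 1 * Φ z 1 1 0 = d z := by
    intro z
    have := (hsol z 0).wronskian (hsol z 1) 1 (right_mem_Icc.2 zero_le_one)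
    simpa [h0] using this
  have hα0 : ∀ᶠ z in F, α z ≠ 0 := hα.eventually_ne one_ne_zero
  have hαi : (fun z => (α z)⁻¹) =O[F] (fun _ => (1 : ℂ)) := (hα.inv₀ one_ne_zero).isBigO_one ℂ
  have hSO : S =O[F] (fun _ => (1 : ℂ)) := formalSum_isBigO_one _ _ _ _ hlt _ _
  have hTO : T =O[F] (fun _ => (1 : ℂ)) := formalSum_isBigO_one _ _ _ _ hlt _ _
  have hmul : ∀ {f g : ℂ → ℂ}, f =o[F] (fun z : ℂ => (z ^ (l + 1))⁻¹) → g =O[F] (fun _ => (1 : ℂ)) →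
      (fun z => f z * g z) =o[F] (fun z : ℂ => (z ^ (l + 1))⁻¹) := fun hf hg => by
    simpa using hf.mul_isBigO hg
  have hβ₁ : min |b₁| b₂ ≤ -b₁ := (min_le_left _ _).trans (abs_of_neg hb₁).le
  have hβ₂ : min |b₁| b₂ ≤ b₂ := min_le_right _ _
  have he₁ : e =o[F] (fun z : ℂ => (z ^ (l + 1))⁻¹) := isLittleO_cexp_of_le fun z hz => by
    have := mul_le_mul_of_nonneg_right hβ₁ hz
    simp
    linarith
  have he₂ : (fun z => d z * e z) =o[F] (fun z : ℂ => (z ^ (l + 1))⁻¹) := by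
    simp only [hd, he, ← Complex.exp_add]
    refine isLittleO_cexp_of_le fun z hz => ?_
    have := mul_le_mul_of_nonneg_right hβ₂ hz
    simp
    linarith
  have heO : e =O[F] (fun _ => (1 : ℂ)) := by
    refine he₁.isBigO.trans (Tendsto.isBigO_one ℂ (c := 0) ?_)
    rw [tendsto_zero_iff_norm_tendsto_zero]
    simp_rw [norm_inv, norm_pow]
    exact tendsto_inv_atTop_zero.comp
      ((tendsto_pow_atTop (Nat.succ_ne_zero l)).comp (tendsto_norm_upperFilter _ _))
  have hρ₁O : (fun z => ρ₁ z * (α z)⁻¹) =o[F] (fun z : ℂ => (z ^ (l + 1))⁻¹) := hmul hρ₁ hαi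
  have hρ₂O : (fun z => ρ₂ z * (α z)⁻¹) =o[F] (fun z : ℂ => (z ^ (l + 1))⁻¹) := hmul hρ₂ hαi
  have hvO : (fun z => T z + ρ₂ z * (α z)⁻¹) =O[F] (fun _ => (1 : ℂ)) := by
    refine hTO.add (hρ₂O.isBigO.trans (Tendsto.isBigO_one ℂ (c := 0) ?_))
    rw [tendsto_zero_iff_norm_tendsto_zero]
    simp_rw [norm_inv, norm_pow]
    exact tendsto_inv_atTop_zero.comp
      ((tendsto_pow_atTop (Nat.succ_ne_zero l)).comp (tendsto_norm_upperFilter _ _))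
  have htr := isLittleO_truncated_product hlt
    (fun k => (-1) ^ (k - 1) * sigmaMinus b₁ b₂ Q₁₂ Q₂₁ k 0)
    (fun k => sigmaPlus b₁ b₂ Q₁₂ Q₂₁ k 1) (l + 1) (min |b₁| b₂)
  rw [← hF] at htr
  have hT : ∀ z, T z = ∑ k ∈ Finset.Icc 1 (l + 1),
      (-1) ^ (k - 1) * sigmaMinus b₁ b₂ Q₁₂ Q₂₁ k 0 * (cConst b₁ b₂ * z)⁻¹ ^ k := by
    intro z
    refine Finset.sum_congr rfl fun k hk => ?_
    rw [sigma_reflect _ _ k (Finset.mem_Icc.1 hk).1, sub_self]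
    rfl
  have hS : ∀ z, S z = ∑ k ∈ Finset.Icc 1 (l + 1),
      sigmaPlus b₁ b₂ Q₁₂ Q₂₁ k 1 * (cConst b₁ b₂ * z)⁻¹ ^ k := fun z => rfl
  simp only [← hT, ← hS] at htr
  set G : ℂ → ℂ := fun z => ∑ k ∈ Finset.Icc 1 (l + 1),
    cPlus b₁ b₂ Q₁₂ Q₂₁ a k / (cConst b₁ b₂ * z) ^ k with hG
  set τ : ℂ → ℂ := fun z => T z * S z - ∑ k ∈ Finset.Icc 1 (l + 1),
    (∑ j ∈ Finset.Icc 1 (k - 1), ((-1) ^ (j - 1) * sigmaMinus b₁ b₂ Q₁₂ Q₂₁ j 0)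
      * sigmaPlus b₁ b₂ Q₁₂ Q₂₁ (k - j) 1) * (cConst b₁ b₂ * z)⁻¹ ^ k with hτ
  have hGτ : ∀ z, J13 a * T z + J42 a * S z + J14 a * (T z * S z) - G z = J14 a * τ z := by
    intro z
    have : G z = ∑ k ∈ Finset.Icc 1 (l + 1),
        cPlus b₁ b₂ Q₁₂ Q₂₁ a k * (cConst b₁ b₂ * z)⁻¹ ^ k :=
      Finset.sum_congr rfl fun k _ => by rw [inv_pow, div_eq_mul_inv]
    rw [this, formal_expansion, ← hT, ← hS, hτ]
    ring
  -- With `1 + s = α` and `r` defined as what is left after division by `α`, the product formula is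
  -- exact wherever `α ≠ 0`; only the size of `r` needs an argument.
  refine ⟨fun z => e z * charDet a Φ z * (α z)⁻¹ - (J32 a + G z), fun z => α z - 1, ?_, ?_, ?_⟩
  · have hsum : (fun z => minorJ a 0 1 * (e z * (α z)⁻¹) + minorJ a 2 3 * (d z * e z * (α z)⁻¹)
        + J13 a * (ρ₂ z * (α z)⁻¹) + J42 a * (ρ₁ z * (α z)⁻¹)
        + J14 a * (d z * e z * e z * (α z)⁻¹ * (α z)⁻¹ + ρ₁ z * (α z)⁻¹ * (T z + ρ₂ z * (α z)⁻¹)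
          + ρ₂ z * (α z)⁻¹ * S z + τ z)) =o[F] (fun z : ℂ => (z ^ (l + 1))⁻¹) :=
      (((((hmul he₁ hαi).const_mul_left _).add ((hmul he₂ hαi).const_mul_left _)).add
        (hρ₂O.const_mul_left _)).add (hρ₁O.const_mul_left _)).add
        (((((hmul (hmul (hmul he₂ heO) hαi) hαi).add (hmul hρ₁O hvO)).add
          (hmul hρ₂O hSO)).add htr).const_mul_left _)
    refine hsum.congr' ?_ EventuallyEq.rfl
    filter_upwards [hα0] with z hz
    have hez : e z ≠ 0 := Complex.exp_ne_zero _
    have hφ : Φ z 1 0 0 ≠ 0 := right_ne_zero_of_mul hz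
    -- The determinant expresses the last entry through the first row and column, so the second
    -- column needs no asymptotics of its own.
    have hφ11 : Φ z 1 1 1 = (d z + Φ z 1 0 1 * Φ z 1 1 0) / Φ z 1 0 0 := by
      rw [eq_div_iff hφ, ← hdet z]
      ring
    have hGz : G z = J13 a * T z + J42 a * S z + J14 a * (T z * S z) - J14 a * τ z := by
      rw [← hGτ z]
      ring
    rw [charDet_eq a Φ z (hΦ z).1, hdet z, hGz, hφ11]
    simp only [ρ₁, ρ₂, hαdef]
    generalize T z = T'
    generalize S z = S'
    generalize τ z = τ'
    field_simp
    ring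
  · rw [isLittleO_one_iff]
    simpa using hα.sub_const 1
  · filter_upwards [hα0] with z hz
    have hee : Complex.exp (Complex.I * b₁ * z) * e z = 1 := by
      rw [he, ← Complex.exp_add, add_neg_cancel, Complex.exp_zero]
    have : Complex.exp (Complex.I * b₁ * z) *
        (J32 a + G z + (e z * charDet a Φ z * (α z)⁻¹ - (J32 a + G z))) * (1 + (α z - 1)) =
        (Complex.exp (Complex.I * b₁ * z) * e z) * charDet a Φ z * (α z * (α z)⁻¹) := by ring
    rw [this, hee, mul_inv_cancel₀ hz]
    ring

/-! ### The symmetry exchanging the two half-planes -/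

lemma qPlus_swap (b : ℝ) (Q : ℝ → ℂ) : qPlus (-b) (fun x => -Q x) = qMinus b Q := by
  ext x
  simp [qPlus, qMinus]

lemma qMinus_swap (b : ℝ) (Q : ℝ → ℂ) : qMinus (-b) (fun x => -Q x) = qPlus b Q := by
  ext x
  simp [qPlus, qMinus]

lemma cConst_swap (b₁ b₂ : ℝ) : cConst (-b₂) (-b₁) = cConst b₁ b₂ := by
  simp only [cConst]
  push_cast
  ring

lemma Solves.swap {μ₁ μ₂ : ℂ} {p m y₁ y₂ : ℝ → ℂ} (h : Solves μ₁ μ₂ p m y₁ y₂) :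
    Solves μ₂ μ₁ m p y₂ y₁ := fun x hx =>
  ⟨(h x hx).2.congr_deriv (add_comm _ _), (h x hx).1.congr_deriv (add_comm _ _)⟩

/-- Under `z ↦ -z` and `y₁ ↔ y₂` the numbers `(b₁, b₂)` become `(-b₂, -b₁)`, which again have signs
`-`, `+`; the potential changes so that `q₊` and `q₋` trade places. -/
lemma IsFundamentalMatrix.swap {b₁ b₂ : ℝ} (h₁ : b₁ ≠ 0) (h₂ : b₂ ≠ 0) {Q₁₂ Q₂₁ : ℝ → ℂ}
    (hp : ContinuousOn (qPlus b₁ Q₁₂) (Icc 0 1)) (hm : ContinuousOn (qMinus b₂ Q₂₁) (Icc 0 1))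
    {Φ : ℂ → ℝ → Matrix (Fin 2) (Fin 2) ℂ} (h : IsFundamentalMatrix b₁ b₂ Q₁₂ Q₂₁ Φ) :
    IsFundamentalMatrix (-b₂) (-b₁) (fun x => -Q₂₁ x) (fun x => -Q₁₂ x)
      (fun z x => (Φ (-z) x).submatrix Fin.rev Fin.rev) := by
  intro z
  refine ⟨?_, fun k => ?_⟩
  · dsimp only
    rw [(h (-z)).1]
    exact Matrix.submatrix_one _ Fin.rev_injective
  · rw [isSolution_iff (neg_ne_zero.2 h₂) (neg_ne_zero.2 h₁) (by rwa [qPlus_swap])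
      (by rwa [qMinus_swap]), qPlus_swap, qMinus_swap]
    have hs := ((isSolution_iff h₁ h₂ hp hm (-z) _).1 ((h (-z)).2 k.rev)).swap
    have e₁ : Complex.I * b₂ * -z = Complex.I * (-b₂ : ℝ) * z := by push_cast; ring
    have e₂ : Complex.I * b₁ * -z = Complex.I * (-b₁ : ℝ) * z := by push_cast; ring
    rw [e₁, e₂] at hs
    exact hs

/-- The columns of `a` after exchanging the components `y₁` and `y₂`. -/
def swapColumns (a : Matrix (Fin 2) (Fin 4) ℂ) : Matrix (Fin 2) (Fin 4) ℂ :=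
  a.submatrix id ![1, 0, 3, 2]

lemma J13_swapColumns (a : Matrix (Fin 2) (Fin 4) ℂ) : J13 (swapColumns a) = -J42 a := by
  simp [J13, J42, minorJ, swapColumns, Matrix.det_fin_two]

lemma J42_swapColumns (a : Matrix (Fin 2) (Fin 4) ℂ) : J42 (swapColumns a) = -J13 a := by
  simp [J13, J42, minorJ, swapColumns, Matrix.det_fin_two]

lemma J14_swapColumns (a : Matrix (Fin 2) (Fin 4) ℂ) : J14 (swapColumns a) = -J32 a := by
  simp [J14, J32, minorJ, swapColumns, Matrix.det_fin_two]

lemma J32_swapColumns (a : Matrix (Fin 2) (Fin 4) ℂ) : J32 (swapColumns a) = -J14 a := by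
  simp [J14, J32, minorJ, swapColumns, Matrix.det_fin_two]

/-- Swapping the columns of `a` compensates the exchange of components in each form `U_j`. The sign
comes from the exchange of the two solutions. -/
lemma charDet_swapColumns (a : Matrix (Fin 2) (Fin 4) ℂ)
    (Φ : ℂ → ℝ → Matrix (Fin 2) (Fin 2) ℂ) (z : ℂ) :
    charDet (swapColumns a) (fun z x => (Φ (-z) x).submatrix Fin.rev Fin.rev) (-z) =
      -charDet a Φ z := by
  simp [charDet, boundaryForm, swapColumns, Matrix.det_fin_two]
  ring

/-- The factor `(-1)^k` is the one produced by `(c · (-z))^k`. The convolution sums are matched by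
`j ↦ k - j`. -/
lemma cPlus_swap (b₁ b₂ : ℝ) (Q₁₂ Q₂₁ : ℝ → ℂ) (a : Matrix (Fin 2) (Fin 4) ℂ) {k : ℕ}
    (hk : 1 ≤ k) :
    (-1) ^ k * cPlus (-b₂) (-b₁) (fun x => -Q₂₁ x) (fun x => -Q₁₂ x) (swapColumns a) k =
      cMinus b₁ b₂ Q₁₂ Q₂₁ a k := by
  have hM : sigmaMinus (-b₂) (-b₁) (fun x => -Q₂₁ x) (fun x => -Q₁₂ x) =
      sigmaPlus b₁ b₂ Q₁₂ Q₂₁ := by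
    rw [sigmaMinus, sigmaPlus, qPlus_swap, qMinus_swap]
  have hP : sigmaPlus (-b₂) (-b₁) (fun x => -Q₂₁ x) (fun x => -Q₁₂ x) =
      sigmaMinus b₁ b₂ Q₁₂ Q₂₁ := by
    rw [sigmaMinus, sigmaPlus, qPlus_swap, qMinus_swap]
  have hsum : (-1) ^ k * ∑ j ∈ Finset.Icc 1 (k - 1), (-1) ^ j * sigmaPlus b₁ b₂ Q₁₂ Q₂₁ j 0
      * sigmaMinus b₁ b₂ Q₁₂ Q₂₁ (k - j) 1 = ∑ j ∈ Finset.Icc 1 (k - 1),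
        (-1) ^ j * sigmaMinus b₁ b₂ Q₁₂ Q₂₁ j 1 * sigmaPlus b₁ b₂ Q₁₂ Q₂₁ (k - j) 0 := by
    rw [Finset.mul_sum]
    refine Finset.sum_nbij' (fun j => k - j) (fun j => k - j) ?_ ?_ ?_ ?_ ?_
    · intro j hj
      rw [Finset.mem_Icc] at hj ⊢
      omega
    · intro j hj
      rw [Finset.mem_Icc] at hj ⊢
      omega
    · intro j hj
      rw [Finset.mem_Icc] at hj
      omega
    · intro j hj
      rw [Finset.mem_Icc] at hj
      omega
    · intro j hj
      rw [Finset.mem_Icc] at hj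
      have e : (-1 : ℂ) ^ k = (-1) ^ (k - j) * (-1) ^ j := by rw [← pow_add]; congr 1; omega
      have e' : (-1 : ℂ) ^ j * (-1) ^ j = 1 := by rw [← mul_pow]; simp
      rw [show k - (k - j) = j by omega, e]
      linear_combination (-1) ^ (k - j) * sigmaPlus b₁ b₂ Q₁₂ Q₂₁ j 0
        * sigmaMinus b₁ b₂ Q₁₂ Q₂₁ (k - j) 1 * e'
  obtain ⟨i, rfl⟩ : ∃ i, k = i + 1 := ⟨k - 1, by omega⟩
  have e : (-1 : ℂ) ^ i * (-1) ^ i = 1 := by rw [← mul_pow]; simp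
  rw [cPlus, cMinus, ← hsum, hM, hP, J13_swapColumns, J42_swapColumns, J14_swapColumns,
    Nat.add_sub_cancel, pow_succ]
  linear_combination J42 a * sigmaPlus b₁ b₂ Q₁₂ Q₂₁ (i + 1) 0 * e

lemma tendsto_neg_lowerFilter (n : ℕ) (β : ℝ) :
    Tendsto (fun z : ℂ => -z) (lowerFilter n β) (upperFilter n β) := by
  refine tendsto_inf.2 ⟨tendsto_comap_iff.2 ?_, tendsto_comap_iff.2 ?_⟩
  · exact tendsto_neg_atBot_atTop.comp (tendsto_comap.mono_left inf_le_left)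
  · have h : Tendsto (fun z : ℂ => ‖z‖ ^ n * Real.exp (-β * |z.im|)) (lowerFilter n β) (𝓝 0) :=
      tendsto_comap.mono_left inf_le_right
    refine h.congr fun z => ?_
    simp

theorem charDet_lower_asymptotics {b₁ b₂ : ℝ} (hb₁ : b₁ < 0) (hb₂ : 0 < b₂) {l : ℕ}
    {Q₁₂ Q₂₁ : ℝ → ℂ} (hp : ACDiff l (qPlus b₁ Q₁₂)) (hm : ACDiff l (qMinus b₂ Q₂₁))
    (a : Matrix (Fin 2) (Fin 4) ℂ) {Φ : ℂ → ℝ → Matrix (Fin 2) (Fin 2) ℂ}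
    (hΦ : IsFundamentalMatrix b₁ b₂ Q₁₂ Q₂₁ Φ) :
    ∃ r s : ℂ → ℂ,
      r =o[lowerFilter (l + 1) (min |b₁| b₂)] (fun z : ℂ => (z ^ (l + 1))⁻¹) ∧
      s =o[lowerFilter (l + 1) (min |b₁| b₂)] (fun _ : ℂ => (1 : ℂ)) ∧
      ∀ᶠ z in lowerFilter (l + 1) (min |b₁| b₂),
        charDet a Φ z = Complex.exp (Complex.I * b₂ * z) *
          (J14 a - ∑ k ∈ Finset.Icc 1 (l + 1),
              cMinus b₁ b₂ Q₁₂ Q₂₁ a k / (cConst b₁ b₂ * z) ^ k + r z) * (1 + s z) := by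
  obtain ⟨r, s, hr, hs, h⟩ := charDet_upper_asymptotics (neg_neg_of_pos hb₂) (neg_pos.2 hb₁)
    (by rwa [qPlus_swap]) (by rwa [qMinus_swap]) (swapColumns a)
    (hΦ.swap hb₁.ne hb₂.ne' hp.continuousOn hm.continuousOn)
  have hmin : min |-b₂| (-b₁) = min |b₁| b₂ := by
    rw [abs_neg, abs_of_pos hb₂, abs_of_neg hb₁, min_comm]
  rw [hmin] at hr hs h
  have ht := tendsto_neg_lowerFilter (l + 1) (min |b₁| b₂)
  refine ⟨fun z => -r (-z), fun z => s (-z), ?_, hs.comp_tendsto ht, ?_⟩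
  · refine IsLittleO.neg_left ?_
    rw [← isLittleO_norm_right]
    simpa [Function.comp_def] using (hr.comp_tendsto ht).norm_right
  · filter_upwards [ht.eventually h] with z hz
    rw [charDet_swapColumns, cConst_swap, J32_swapColumns] at hz
    have hexp : Complex.I * (-b₂ : ℝ) * -z = Complex.I * b₂ * z := by push_cast; ring
    have hsum : ∑ k ∈ Finset.Icc 1 (l + 1),
        cPlus (-b₂) (-b₁) (fun x => -Q₂₁ x) (fun x => -Q₁₂ x) (swapColumns a) k
          / (cConst b₁ b₂ * -z) ^ k =
        ∑ k ∈ Finset.Icc 1 (l + 1), cMinus b₁ b₂ Q₁₂ Q₂₁ a k / (cConst b₁ b₂ * z) ^ k := by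
      refine Finset.sum_congr rfl fun k hk => ?_
      rw [← cPlus_swap b₁ b₂ Q₁₂ Q₂₁ a (Finset.mem_Icc.1 hk).1, mul_neg, neg_pow,
        mul_comm ((-1 : ℂ) ^ k) ((_ : ℂ) ^ k), ← div_div, mul_div_right_comm, div_right_comm]
      rcases neg_one_pow_eq_or ℂ k with e | e <;> simp [e, div_eq_mul_inv] <;> ring
    rw [hexp, hsum] at hz
    linear_combination -hz

end DiracType

theorem mainTheorem2 (b₁ b₂ : ℝ) (hb₁ : b₁ < 0) (hb₂ : 0 < b₂)
    (n : ℕ) (hn : 1 ≤ n) (Q₁₂ Q₂₁ : ℝ → ℂ)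
    (hQ₁₂ : DiracType.SobolevW1 n Q₁₂) (hQ₂₁ : DiracType.SobolevW1 n Q₂₁)
    (a : Matrix (Fin 2) (Fin 4) ℂ) :
    (∃ Φ : ℂ → ℝ → Matrix (Fin 2) (Fin 2) ℂ,
      DiracType.IsFundamentalMatrix b₁ b₂ Q₁₂ Q₂₁ Φ) ∧
    ∀ Φ : ℂ → ℝ → Matrix (Fin 2) (Fin 2) ℂ,
      DiracType.IsFundamentalMatrix b₁ b₂ Q₁₂ Q₂₁ Φ →
      (∃ r s : ℂ → ℂ,
        r =o[DiracType.upperFilter n (min |b₁| b₂)] (fun z : ℂ => (z ^ n)⁻¹) ∧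
        s =o[DiracType.upperFilter n (min |b₁| b₂)] (fun _ : ℂ => (1 : ℂ)) ∧
        ∀ᶠ z in DiracType.upperFilter n (min |b₁| b₂),
          DiracType.charDet a Φ z =
            Complex.exp (Complex.I * b₁ * z) *
              (DiracType.J32 a
                + ∑ k ∈ Finset.Icc 1 n,
                    DiracType.cPlus b₁ b₂ Q₁₂ Q₂₁ a k / (DiracType.cConst b₁ b₂ * z) ^ k
                + r z) * (1 + s z)) ∧
      (∃ r s : ℂ → ℂ,
        r =o[DiracType.lowerFilter n (min |b₁| b₂)] (fun z : ℂ => (z ^ n)⁻¹) ∧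
        s =o[DiracType.lowerFilter n (min |b₁| b₂)] (fun _ : ℂ => (1 : ℂ)) ∧
        ∀ᶠ z in DiracType.lowerFilter n (min |b₁| b₂),
          DiracType.charDet a Φ z =
            Complex.exp (Complex.I * b₂ * z) *
              (DiracType.J14 a
                - ∑ k ∈ Finset.Icc 1 n,
                    DiracType.cMinus b₁ b₂ Q₁₂ Q₂₁ a k / (DiracType.cConst b₁ b₂ * z) ^ k
                + r z) * (1 + s z)) := by
  -- Membership in `W_1^{l+1}` gives `l` derivatives, the last one absolutely continuous, which is
  -- the form of regularity used throughout.
  obtain ⟨l, rfl⟩ : ∃ l, n = l + 1 := ⟨n - 1, by omega⟩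
  have hp : DiracType.ACDiff l (DiracType.qPlus b₁ Q₁₂) :=
    (DiracType.ACDiff.of_sobolevW1 hQ₁₂).const_mul _
  have hm : DiracType.ACDiff l (DiracType.qMinus b₂ Q₂₁) :=
    (DiracType.ACDiff.of_sobolevW1 hQ₂₁).const_mul _
  exact ⟨DiracType.exists_isFundamentalMatrix hb₁.ne hb₂.ne' hp.continuousOn hm.continuousOn,
    fun Φ hΦ => ⟨DiracType.charDet_upper_asymptotics hb₁ hb₂ hp hm a hΦ,
      DiracType.charDet_lower_asymptotics hb₁ hb₂ hp hm a hΦ⟩⟩
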